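/- Let $\mathbb K=\mathbb R$ or $\mathbb C$. "Smooth" means infinitely differentiable (holomorphic if $\mathbb K=\mathbb C$); the statement also holds with "smooth" read as real analytic throughout. Let $\mathcal E_p$ be the ring of germs at $0$ of smooth functions $\mathbb K^p\to\mathbb K$ and $\mathfrak m=\mathfrak m_p$ its maximal ideal of germs vanishing at $0$. For a smooth map germ $h:(\mathbb K^p,0)\to(\mathbb K^q,0)$ let $\theta(h)\cong\mathcal E_p^{\,q}$ be the $\mathcal E_p$-module of germs of vector fields along $h$, let $h^*(\mathfrak m_q)$ be the ideal of $\mathcal E_p$ generated by the germs $\varphi\circ h$ with $\varphi\in\mathfrak m_q$, and for a germ $\xi$ of a vector field on $\mathbb K^p$ at $0$ let $\xi(h)=dh(\xi)\in\theta(h)$. Let $V$ be an arbitrary germ at $0$ of a subset of $\mathbb K^p$. Let $\Theta_V$ be the set of germs at $0$ of smooth vector fields on $\mathbb K^p$ whose local flow $\Phi_t$ (with time $t\in\mathbb K$) preserves $V$, i.e. $\Phi_t(x)\in V\iff x\in V$ for all $(t,x)$ near $(0,0)$. Let $\Theta_{V,1}\subseteq\Theta_V$ be the set of those for which in addition, for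 all small $t$, $\Phi_t$ fixes $0$ and has $1$-jet at $0$ equal to that of the identity. Put $$T_V\mathcal K_1(h)=\{\xi(h)\mid\xi\in\Theta_{V,1}\}+\mathfrak m_p\,h^*(\mathfrak m_q)\,\theta(h),\qquad T_V\mathcal K_e(h)=\{\xi(h)\mid\xi\in\Theta_V\}+h^*(\mathfrak m_q)\,\theta(h).$$ Two smooth map germs $f,g:(\mathbb K^p,0)\to(\mathbb K^q,0)$ are ${}_V\mathcal K$-equivalent if there are germs of diffeomorphisms $\Psi$ of $(\mathbb K^p\times\mathbb K^q,(0,0))$ and $\psi$ of $(\mathbb K^p,0)$ such that the first component of $\Psi(x,y)$ is $\psi(x)$, $\Psi(\mathbb K^p\times\{0\})=\mathbb K^p\times\{0\}$, $\Psi(\operatorname{graph} f)=\operatorname{graph} g$ and $\psi(V)=V$ (equalities of set germs). For an integer $l\ge 0$, $h$ is $l$-${}_V\mathcal K$-determined if every smooth map germ $g:(\mathbb K^p,0)\to(\mathbb K^q,0)$ with the same $l$-jet at $0$ as $h$ is ${}_V\mathcal K$-equivalent to $h$. **Theorem 3.6.** Let $h:(\mathbb K^p,0)\to(\mathbb K^q,0)$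 be a smooth map germ, let $l\ge 0$ be an integer, and suppose that $\Theta_V$ is finitely generated as an $\mathcal E_p$-module. (i) If $\mathfrak m^{l+1}\theta(h)\subseteq T_V\mathcal K_1(h)+\mathfrak m^{l+2}\theta(h)$, then $h$ is $l$-${}_V\mathcal K$-determined. (ii) If every vector field in $\Theta_V$ vanishes at the origin and $\mathfrak m^{l}\theta(h)\subseteq T_V\mathcal K_e(h)+\mathfrak m^{l+1}\theta(h)$, then $h$ is $l$-${}_V\mathcal K$-determined. -/

import Mathlib

open scoped Topology ContDiff Pointwise

noncomputable section

namespace VK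

/-- The two standard categories of germs: infinitely differentiable and analytic.
Over `ℂ` both give the holomorphic germs. -/
inductive Regularity
  | smooth
  | analytic

/-- The order of differentiability in Mathlib's `ContDiff` scale. -/
def Regularity.order : Regularity → WithTop ℕ∞
  | .smooth => ∞
  | .analytic => ω

theorem Regularity.order_add_one (r : Regularity) : r.order + 1 ≤ r.order := by
  cases r <;> exact le_of_eq rfl

section Germs

variable (𝕂 : Type*) [RCLike 𝕂] (r : Regularity)

/-- `f` is smooth on some neighbourhood of the origin. -/
def SmoothNear {E F : Type*} [NormedAddCommGroup E] [NormedSpace 𝕂 E]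
    [NormedAddCommGroup F] [NormedSpace 𝕂 F] (f : E → F) : Prop :=
  ∀ᶠ x in 𝓝 (0 : E), ContDiffAt 𝕂 r.order f x

/-- The ring `ℰ_p` of germs at `0` of smooth functions `𝕂^p → 𝕂`. -/
def SmoothGerm (p : ℕ) : Subring (Filter.Germ (𝓝 (0 : Fin p → 𝕂)) 𝕂) where
  carrier := {f | ∃ F : (Fin p → 𝕂) → 𝕂, SmoothNear 𝕂 r F ∧ f = (F : Filter.Germ _ 𝕂)}
  mul_mem' := by
    rintro _ _ ⟨F, hF, rfl⟩ ⟨G, hG, rfl⟩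
    exact ⟨F * G, by filter_upwards [hF, hG] with x h1 h2 using h1.mul h2, rfl⟩
  one_mem' := ⟨1, Filter.Eventually.of_forall fun _ => contDiffAt_const, rfl⟩
  add_mem' := by
    rintro _ _ ⟨F, hF, rfl⟩ ⟨G, hG, rfl⟩
    exact ⟨F + G, by filter_upwards [hF, hG] with x h1 h2 using h1.add h2, rfl⟩
  zero_mem' := ⟨0, Filter.Eventually.of_forall fun _ => contDiffAt_const, rfl⟩
  neg_mem' := by
    rintro _ ⟨F, hF, rfl⟩
    exact ⟨-F, by filter_upwards [hF] with x h1 using h1.neg, rfl⟩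

/-- The maximal ideal `𝔪_p` of `ℰ_p`: the germs that vanish at the origin. -/
def maxIdeal (p : ℕ) : Ideal (SmoothGerm 𝕂 r p) :=
  RingHom.ker ((Filter.Germ.valueRingHom).comp (SmoothGerm 𝕂 r p).subtype)

/-- `q`-tuples of germs in `ℰ_p`. These are the germs of smooth maps `𝕂^p → 𝕂^q`, the module
`θ(h)` of vector fields along a map germ `h`, and for `q = p` the germs of vector fields on
`𝕂^p`. -/
abbrev Tuple (p q : ℕ) : Type _ := Fin q → SmoothGerm 𝕂 r p

variable {𝕂 r}

/-- The function `F` represents the germ `f`. -/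
def Represents {p q : ℕ} (F : (Fin p → 𝕂) → (Fin q → 𝕂)) (f : Tuple 𝕂 r p q) : Prop :=
  ∀ i, (f i : Filter.Germ (𝓝 (0 : Fin p → 𝕂)) 𝕂) = ((fun x => F x i : (Fin p → 𝕂) → 𝕂) :
    Filter.Germ (𝓝 (0 : Fin p → 𝕂)) 𝕂)

/-- The partial derivative `∂f/∂x_j` of a germ. -/
def pderiv {p : ℕ} (j : Fin p) (f : SmoothGerm 𝕂 r p) : SmoothGerm 𝕂 r p :=
  ⟨Filter.Germ.map' (fun F x => fderiv 𝕂 F x (Pi.single j 1))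
      (fun _ _ h => h.fderiv.fun_comp fun L => L (Pi.single j 1)) f.1, by
    obtain ⟨_, F, hF, rfl⟩ := f
    refine ⟨fun x => fderiv 𝕂 F x (Pi.single j 1), ?_, rfl⟩
    filter_upwards [hF] with x hx
    exact (hx.fderiv_right r.order_add_one).clm_apply contDiffAt_const⟩

/-- `ξ(h) = dh(ξ)`, the derivative of the map germ `h` along the vector field `ξ`. -/
def applyField {p q : ℕ} (ξ : Tuple 𝕂 r p p) (h : Tuple 𝕂 r p q) : Tuple 𝕂 r p q :=
  fun i => ∑ j, ξ j * pderiv j (h i)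

/-- The `l`-jet at the origin, as the family of all derivatives of order at most `l`. -/
def jet {p : ℕ} (l : ℕ) (f : SmoothGerm 𝕂 r p) :
    (k : Fin (l + 1)) → ContinuousMultilinearMap 𝕂 (fun _ : Fin k => Fin p → 𝕂) 𝕂 :=
  fun k => Filter.Germ.liftOn f.1 (fun F => iteratedFDeriv 𝕂 k F 0)
    fun _ _ h => (h.iteratedFDeriv 𝕂 k).eq_of_nhds

/-- `h^*(𝔪_q)`, the ideal of `ℰ_p` generated by the compositions `φ ∘ h` with `φ ∈ 𝔪_q`. -/
def pullbackMax {p q : ℕ} (h : Tuple 𝕂 r p q) : Ideal (SmoothGerm 𝕂 r p) :=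
  Ideal.span {f | ∃ φ ∈ maxIdeal 𝕂 r q, ∃ (Φ : (Fin q → 𝕂) → 𝕂) (H : (Fin p → 𝕂) → (Fin q → 𝕂)),
    φ.1 = (Φ : Filter.Germ (𝓝 (0 : Fin q → 𝕂)) 𝕂) ∧ Represents H h ∧
    f.1 = ((Φ ∘ H : (Fin p → 𝕂) → 𝕂) : Filter.Germ (𝓝 (0 : Fin p → 𝕂)) 𝕂)}

/-- The submodule `I θ(h)` of `θ(h)`. -/
def idealTheta {p : ℕ} (q : ℕ) (I : Ideal (SmoothGerm 𝕂 r p)) :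
    Submodule (SmoothGerm 𝕂 r p) (Tuple 𝕂 r p q) :=
  I • ⊤

/-- `Φ` is the local flow at the origin of the vector field germ `ξ`, with time in `𝕂`. -/
def IsLocalFlow {p : ℕ} (ξ : Tuple 𝕂 r p p) (Φ : 𝕂 → (Fin p → 𝕂) → (Fin p → 𝕂)) : Prop :=
  ∃ X : (Fin p → 𝕂) → (Fin p → 𝕂), Represents X ξ ∧
    ∀ᶠ z : 𝕂 × (Fin p → 𝕂) in 𝓝 0,
      Φ 0 z.2 = z.2 ∧ HasDerivAt (fun s => Φ s z.2) (X (Φ z.1 z.2)) z.1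

/-- The diffeomorphisms `Φ t`, for small `t`, preserve the germ at the origin of the set `V`. -/
def FlowPreserves {p : ℕ} (V : Set (Fin p → 𝕂)) (Φ : 𝕂 → (Fin p → 𝕂) → (Fin p → 𝕂)) : Prop :=
  ∀ᶠ z : 𝕂 × (Fin p → 𝕂) in 𝓝 0, (Φ z.1 z.2 ∈ V ↔ z.2 ∈ V)

variable (r)

/-- `Θ_V`: the vector fields that integrate to diffeomorphisms preserving the set germ `V`. -/
def Theta {p : ℕ} (V : Set (Fin p → 𝕂)) : Set (Tuple 𝕂 r p p) :=
  {ξ | ∃ Φ, IsLocalFlow ξ Φ ∧ FlowPreserves V Φ}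

/-- `Θ_{V,1}`: the vector fields that integrate to diffeomorphisms of `(𝕂^p, 0)` with `1`-jet
the identity that preserve `V`. -/
def ThetaOne {p : ℕ} (V : Set (Fin p → 𝕂)) : Set (Tuple 𝕂 r p p) :=
  {ξ | ∃ Φ, IsLocalFlow ξ Φ ∧ FlowPreserves V Φ ∧
    ∀ᶠ t in 𝓝 (0 : 𝕂), Φ t 0 = 0 ∧ HasFDerivAt (Φ t) (ContinuousLinearMap.id 𝕂 (Fin p → 𝕂)) 0}

variable {r}

/-- `T_V 𝒦_e(h) = {ξ(h) | ξ ∈ Θ_V} + h^*(𝔪_q) θ(h)`. -/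
def tangentExt {p q : ℕ} (V : Set (Fin p → 𝕂)) (h : Tuple 𝕂 r p q) : Set (Tuple 𝕂 r p q) :=
  (fun ξ => applyField ξ h) '' Theta r V + (idealTheta q (pullbackMax h) : Set (Tuple 𝕂 r p q))

/-- `T_V 𝒦_1(h) = {ξ(h) | ξ ∈ Θ_{V,1}} + 𝔪_p h^*(𝔪_q) θ(h)`. -/
def tangentOne {p q : ℕ} (V : Set (Fin p → 𝕂)) (h : Tuple 𝕂 r p q) : Set (Tuple 𝕂 r p q) :=
  (fun ξ => applyField ξ h) '' ThetaOne r V +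
    (idealTheta q (maxIdeal 𝕂 r p * pullbackMax h) : Set (Tuple 𝕂 r p q))

variable (𝕂 r)

/-- `ψ` is a germ of a diffeomorphism `(E, 0) → (E, 0)`. -/
def IsDiffeoGerm {E : Type*} [NormedAddCommGroup E] [NormedSpace 𝕂 E] (ψ : E → E) : Prop :=
  ψ 0 = 0 ∧ SmoothNear 𝕂 r ψ ∧
    ∃ χ : E → E, χ 0 = 0 ∧ SmoothNear 𝕂 r χ ∧
      (∀ᶠ x in 𝓝 0, χ (ψ x) = x) ∧ (∀ᶠ x in 𝓝 0, ψ (χ x) = x)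

/-- `ψ (A) = B` as set germs at the origin, for a diffeomorphism germ `ψ` fixing the origin. -/
def MapsGermOnto {E : Type*} [NormedAddCommGroup E] (ψ : E → E) (A B : Set E) : Prop :=
  ∀ᶠ x in 𝓝 0, (x ∈ A ↔ ψ x ∈ B)

variable {𝕂 r}

/-- `_V𝒦`-equivalence of map germs `(𝕂^p, 0) → (𝕂^q, 0)`: a diffeomorphism germ `Ψ` of
`𝕂^p × 𝕂^q`, fibred over a diffeomorphism germ `ψ` of `𝕂^p`, that preserves `𝕂^p × 0` and maps
graph to graph, such that `ψ` preserves `V`. -/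
def Equivalent {p q : ℕ} (V : Set (Fin p → 𝕂)) (f g : Tuple 𝕂 r p q) : Prop :=
  ∃ F G : (Fin p → 𝕂) → (Fin q → 𝕂), Represents F f ∧ Represents G g ∧
    ∃ (Ψ : (Fin p → 𝕂) × (Fin q → 𝕂) → (Fin p → 𝕂) × (Fin q → 𝕂))
      (ψ : (Fin p → 𝕂) → (Fin p → 𝕂)),
      IsDiffeoGerm 𝕂 r Ψ ∧ IsDiffeoGerm 𝕂 r ψ ∧
      (∀ᶠ z in 𝓝 0, (Ψ z).1 = ψ z.1) ∧
      MapsGermOnto Ψ {z | z.2 = 0} {z | z.2 = 0} ∧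
      MapsGermOnto Ψ {z | z.2 = F z.1} {z | z.2 = G z.1} ∧
      MapsGermOnto ψ V V

/-- `h` is `l`-`_V𝒦`-determined: every map germ `(𝕂^p, 0) → (𝕂^q, 0)` with the same `l`-jet as
`h` is `_V𝒦`-equivalent to `h`. -/
def Determined {p q : ℕ} (V : Set (Fin p → 𝕂)) (l : ℕ) (h : Tuple 𝕂 r p q) : Prop :=
  ∀ g : Tuple 𝕂 r p q, (∀ i, g i ∈ maxIdeal 𝕂 r p) → (∀ i, jet l (g i) = jet l (h i)) →
    Equivalent V h g

end Germs

end VK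

end

/-! The proof is the homotopy method: join `h` to `g` by `H_t = h + tΔ` with `Δ = g - h`, and show
that near every `t` in `[0, 1]` the equivalence class of `H_t` does not change. Equivalence is used
in the matrix form `H_t(φ x) = M x (H_s x)`, with `φ` preserving `V` and `M` invertible
(`ContactEquivalent`). By connectedness of `[0, 1]` these local equivalences combine into one
between the endpoints.

To move along the path one solves the infinitesimal equation `∂H_t/∂t + dH_t(η) = B H_t`. Apply the
tangent space hypothesis to the finitely many monomial fields `e_a` generating `𝔪^k θ(h)`. This
gives `ξ_a` and matrices `W_a` with `dh(ξ_a) + W_a h = e_a` modulo `𝔪 · (e_b)`. The jet condition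
makes `dΔ(ξ_a) + W_a Δ` another combination of the `e_b` with coefficients in `𝔪`. So for `H_t` the
left-hand sides are the `e_a` transformed by a matrix that is the identity at `x = 0` for every `t`.
Inverting it, an explicit Nakayama argument, expresses `Δ` by these left-hand sides, with
coefficients smooth in `(t, x)` (`contactEquivalent_add`). Both parts of the theorem are instances
of `equivalent_of_tangent` and differ only in counting orders of vanishing. The fields of `Θ_{V,1}`
lie in `𝔪²` by symmetry of second derivatives of their flow.

Integrating the equation is `exists_equivalence_of_infinitesimal`: the flow of `(1, η)` gives `φ`, a
linear differential equation gives `M`, and uniqueness of solutions gives the conjugation. The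
delicate point is that `φ` preserves `V`. Since `V` is an arbitrary set and `η = -∑ α_a(t, x) ξ_a`
has variable coefficients, no tangency criterion is available. Instead `invariant_of_mem_span` uses
orbits, in the style of Sussmann. An immersed piece of maximal dimension in the orbit of a point
under local diffeomorphisms preserving `V` is tangent to all generators. It is therefore tangent to
any smooth pointwise combination of them, whose integral curves stay in the orbit.

The smooth, real analytic and holomorphic cases are treated together. The superposition operator `α
↦ f ∘ α` on continuous paths inherits the regularity of `f`. Smooth dependence of flows then follows
from the inverse function theorem in a Banach space of paths, and Hadamard's lemma from integration
along rays. -/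

open Filter Set

namespace VK

/-! ### Regularity of the superposition operator on spaces of paths. -/

section Superposition

universe u

variable {I : Type*} [TopologicalSpace I]

open Classical in
/-- The superposition (Nemytskii) operator `α ↦ f ∘ α` on continuous paths. -/
noncomputable def superposition {E F : Type*} [TopologicalSpace E] [TopologicalSpace F] [Zero F]
    (f : E → F) (α : C(I, E)) : C(I, F) :=
  -- The default value plays no role: the operator is only evaluated on paths along which `f` is
  -- continuous.
  if h : Continuous (f ∘ α) then ⟨f ∘ α, h⟩ else 0

theorem superposition_apply {E F : Type*} [TopologicalSpace E] [TopologicalSpace F] [Zero F]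
    {f : E → F} {α : C(I, E)} (h : ∀ s, ContinuousAt f (α s)) (s : I) :
    superposition f α s = f (α s) := by
  have : Continuous (f ∘ α) :=
    continuous_iff_continuousAt.2 fun s => (h s).comp α.continuous.continuousAt
  simp [superposition, this]

variable [CompactSpace I]

theorem isOpen_paths {E : Type*} [TopologicalSpace E] {U : Set E} (hU : IsOpen U) :
    IsOpen {α : C(I, E) | ∀ s, α s ∈ U} := by
  simpa [MapsTo] using ContinuousMap.isOpen_setOfPred_mapsTo (isCompact_univ (X := I)) hU

variable {E F : Type*} [NormedAddCommGroup E] [NormedAddCommGroup F]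

/-- The image of `α` is compact, so continuity of `f` at its points is uniform along it, even when
the second point compared lies off the image. -/
theorem continuousAt_superposition {f : E → F} {U : Set E} (hU : IsOpen U)
    (hf : ∀ x ∈ U, ContinuousAt f x) {α : C(I, E)} (hα : ∀ s, α s ∈ U) :
    ContinuousAt (superposition (I := I) f) α := by
  rw [Metric.continuousAt_iff']
  intro ε hε
  have hK : IsCompact (range α) := isCompact_range α.continuous
  have h1 := hK.uniformContinuousAt_of_continuousAt f
    (by rintro _ ⟨s, rfl⟩; exact hf _ (hα s)) (Metric.dist_mem_uniformity (half_pos hε))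
  obtain ⟨δ, hδ, h2⟩ := Metric.mem_uniformity_dist.1 h1
  filter_upwards [Metric.ball_mem_nhds α hδ, (isOpen_paths hU).mem_nhds hα] with β hβ hβU
  refine lt_of_le_of_lt ((ContinuousMap.dist_le (half_pos hε).le).2 fun s => ?_) (half_lt_self hε)
  rw [superposition_apply fun s => hf _ (hβU s), superposition_apply fun s => hf _ (hα s),
    dist_comm]
  refine (h2 (a := α s) (b := β s) ?_ ⟨s, rfl⟩).le
  rw [dist_comm]
  exact lt_of_le_of_lt (ContinuousMap.dist_apply_le_dist s) hβ

section Derivative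

variable (𝕂 : Type*) [RCLike 𝕂] {E F : Type*} [NormedAddCommGroup E] [NormedSpace 𝕂 E]
  [NormedAddCommGroup F] [NormedSpace 𝕂 F]

variable (I E F) in
/-- Pointwise application of a path of operators to a path of vectors. -/
noncomputable def pathApply : C(I, E →L[𝕂] F) →L[𝕂] C(I, E) →L[𝕂] C(I, F) :=
  LinearMap.mkContinuous₂
    (LinearMap.mk₂ 𝕂 (fun (A : C(I, E →L[𝕂] F)) (β : C(I, E)) =>
        (⟨fun s => A s (β s), A.continuous.clm_apply β.continuous⟩ : C(I, F)))
      (by intros; ext; simp) (by intros; ext; simp) (by intros; ext; simp) (by intros; ext; simp))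
    1 (by
      intro A β
      rw [ContinuousMap.norm_le _ (by positivity)]
      intro s
      rw [one_mul]
      exact (ContinuousLinearMap.le_opNorm _ _).trans
        (by gcongr; exacts [A.norm_coe_le_norm s, β.norm_coe_le_norm s]))

theorem pathApply_apply (A : C(I, E →L[𝕂] F)) (β : C(I, E)) (s : I) :
    pathApply I 𝕂 E F A β s = A s (β s) := rfl

variable {𝕂}

/-- Continuity of the superposition operator of `f'` bounds the oscillation of `f'` on balls around
`α s` of a radius independent of `s`. The mean value inequality at each `s` then gives a remainder
estimate uniform in `s`. -/
theorem hasFDerivAt_superposition {f : E → F} {f' : E → E →L[𝕂] F} {U : Set E} (hU : IsOpen U)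
    (hf : ∀ x ∈ U, HasFDerivAt f (f' x) x) (hf' : ∀ x ∈ U, ContinuousAt f' x)
    {α : C(I, E)} (hα : ∀ s, α s ∈ U) :
    HasFDerivAt (superposition (I := I) f) (pathApply I 𝕂 E F (superposition f' α)) α := by
  let _ : NormedSpace ℝ E := NormedSpace.restrictScalars ℝ 𝕂 E
  refine HasFDerivAt.of_isLittleO (Asymptotics.isLittleO_iff.2 fun c hc => ?_)
  obtain ⟨δ, hδ, h1⟩ := Metric.eventually_nhds_iff_ball.1
    ((Metric.continuousAt_iff'.1 (continuousAt_superposition hU hf' hα) c hc).and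
      ((isOpen_paths hU).mem_nhds hα))
  filter_upwards [Metric.ball_mem_nhds α hδ] with β hβ
  rw [ContinuousMap.norm_le _ (by positivity)]
  intro s
  have hcont := fun x hx => (hf x hx).continuousAt
  simp only [ContinuousMap.sub_apply, pathApply_apply]
  rw [superposition_apply fun s => hcont _ ((h1 β hβ).2 s),
    superposition_apply fun s => hcont _ (hα s)]
  have key : ∀ y ∈ Metric.ball (α s) δ, y ∈ U ∧ ‖f' y - superposition f' α s‖ ≤ c := by
    intro y hy
    -- A point `y` near `α s` is the value at `s` of a translate of `α`, so estimates on paths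
    -- become estimates on points.
    have hγ : α + ContinuousMap.const I (y - α s) ∈ Metric.ball α δ := by
      rw [mem_ball_iff_norm, add_sub_cancel_left]
      refine lt_of_le_of_lt ?_ (mem_ball_iff_norm.1 hy)
      rw [ContinuousMap.norm_le _ (norm_nonneg _)]
      intro t; simp
    obtain ⟨h2, h3⟩ := h1 _ hγ
    have h4 : (α + ContinuousMap.const I (y - α s)) s = y := by simp
    refine ⟨h4 ▸ h3 s, ?_⟩
    have h5 := superposition_apply (fun s => hf' _ (h3 s)) s
    rw [h4] at h5
    rw [← h5, ← ContinuousMap.sub_apply]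
    exact (ContinuousMap.norm_coe_le_norm _ s).trans (by rw [← dist_eq_norm]; exact h2.le)
  have hb : β s ∈ Metric.ball (α s) δ :=
    lt_of_le_of_lt (ContinuousMap.dist_apply_le_dist s) hβ
  refine ((convex_ball (α s) δ).norm_image_sub_le_of_norm_hasFDerivWithin_le'
    (fun x hx => (hf x (key x hx).1).hasFDerivWithinAt) (fun x hx => (key x hx).2)
    (Metric.mem_ball_self hδ) hb).trans ?_
  gcongr
  rw [← ContinuousMap.sub_apply]
  exact ContinuousMap.norm_coe_le_norm _ s

end Derivative

section Smooth

variable {𝕂 : Type*} [RCLike 𝕂]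

/-- The derivative of the operator is built from the superposition operator of `fderiv 𝕂 f`, so
induction applies with `F` replaced by `E →L[𝕂] F`. This change of target is why both spaces share a
universe. -/
theorem contDiffOn_superposition_nat (n : ℕ) {E F : Type u} [NormedAddCommGroup E]
    [NormedSpace 𝕂 E] [NormedAddCommGroup F] [NormedSpace 𝕂 F] {f : E → F} {U : Set E}
    (hU : IsOpen U) (hf : ContDiffOn 𝕂 n f U) :
    ContDiffOn 𝕂 n (superposition (I := I) f) {α | ∀ s, α s ∈ U} := by
  induction n generalizing F with
  | zero =>
    refine contDiffOn_zero.2 fun α hα => ContinuousAt.continuousWithinAt ?_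
    exact continuousAt_superposition hU
      (fun x hx => hf.continuousOn.continuousAt (hU.mem_nhds hx)) hα
  | succ n ih =>
    have h1 : ContDiffOn 𝕂 n (fderiv 𝕂 f) U := hf.fderiv_of_isOpen hU (by norm_cast)
    rw [Nat.cast_add, Nat.cast_one,
      contDiffOn_succ_iff_hasFDerivWithinAt_of_uniqueDiffOn (isOpen_paths hU).uniqueDiffOn]
    refine ⟨by simp, _, (pathApply I 𝕂 E F).contDiff.comp_contDiffOn (ih h1), fun α hα =>
      (hasFDerivAt_superposition hU (fun x hx => ?_) (fun x hx => ?_) hα).hasFDerivWithinAt⟩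
    · exact ((hf.contDiffAt (hU.mem_nhds hx)).differentiableAt (by simp)).hasFDerivAt
    · exact h1.continuousOn.continuousAt (hU.mem_nhds hx)

theorem contDiffOn_superposition {E F : Type u} [NormedAddCommGroup E]
    [NormedSpace 𝕂 E] [NormedAddCommGroup F] [NormedSpace 𝕂 F] {f : E → F} {U : Set E}
    (hU : IsOpen U) (hf : ContDiffOn 𝕂 ∞ f U) :
    ContDiffOn 𝕂 ∞ (superposition (I := I) f) {α | ∀ s, α s ∈ U} :=
  contDiffOn_infty.2 fun n => contDiffOn_superposition_nat n hU (contDiffOn_infty.1 hf n)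

variable (I) in
/-- The multilinear map on paths given by the pointwise application of a multilinear map. -/
noncomputable def pathMultilinear {E F : Type*} [NormedAddCommGroup E] [NormedSpace 𝕂 E]
    [NormedAddCommGroup F] [NormedSpace 𝕂 F] {n : ℕ} (A : E [×n]→L[𝕂] F) :
    C(I, E) [×n]→L[𝕂] C(I, F) :=
  MultilinearMap.mkContinuous
    { toFun := fun m => ⟨fun s => A fun i => m i s, A.cont.comp (by fun_prop)⟩
      map_update_add' := by
        intro _ m i a b
        ext s
        have (c : C(I, E)) : (fun j => Function.update m i c j s) =
            Function.update (fun j => m j s) i (c s) := by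
          ext j; rcases eq_or_ne j i with rfl | h <;> simp [*]
        simp [this]
      map_update_smul' := by
        intro _ m i a b
        ext s
        have (c : C(I, E)) : (fun j => Function.update m i c j s) =
            Function.update (fun j => m j s) i (c s) := by
          ext j; rcases eq_or_ne j i with rfl | h <;> simp [*]
        simp [this] }
    ‖A‖ (by
      intro m
      rw [ContinuousMap.norm_le _ (by positivity)]
      exact fun s => (A.le_opNorm _).trans (mul_le_mul_of_nonneg_left
        (Finset.prod_le_prod (fun _ _ => norm_nonneg _) fun i _ => (m i).norm_coe_le_norm s)
        (norm_nonneg _)))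

theorem norm_pathMultilinear_le {E F : Type*} [NormedAddCommGroup E] [NormedSpace 𝕂 E]
    [NormedAddCommGroup F] [NormedSpace 𝕂 F] {n : ℕ} (A : E [×n]→L[𝕂] F) :
    ‖pathMultilinear I A‖ ≤ ‖A‖ :=
  MultilinearMap.mkContinuous_norm_le _ (norm_nonneg _) _

/-- At a constant path the power series of `f` acts pointwise in the parameter with no larger norms,
so it converges in the sup norm. Constant paths suffice: both Hadamard's lemma and the construction
of flows work near one. -/
theorem analyticAt_superposition {E F : Type*} [NormedAddCommGroup E] [NormedSpace 𝕂 E]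
    [NormedAddCommGroup F] [NormedSpace 𝕂 F] [CompleteSpace F] {f : E → F} {x : E}
    (hf : AnalyticAt 𝕂 f x) :
    AnalyticAt 𝕂 (superposition (I := I) f) (ContinuousMap.const I x) := by
  obtain ⟨p, r, hp⟩ := hf
  obtain ⟨r', hr', hr'r⟩ := ENNReal.lt_iff_exists_nnreal_btwn.1 hp.r_pos
  have hrad : (r' : ENNReal) < p.radius := hr'r.trans_le hp.r_le
  refine ⟨fun n => pathMultilinear I (p n), r', ?_, hr', ?_⟩
  · refine FormalMultilinearSeries.le_radius_of_summable_norm _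
      ((p.summable_norm_mul_pow hrad).of_nonneg_of_le (fun n => by positivity) fun n => ?_)
    gcongr
    exact norm_pathMultilinear_le _
  · intro α hα
    have hα' : ‖α‖ < r' := by simpa using hα
    have hs (s : I) : α s ∈ Metric.eball (0 : E) r := by
      refine lt_of_le_of_lt ?_ hr'r
      rw [edist_zero_right]
      exact_mod_cast (α.norm_coe_le_norm s).trans hα'.le
    have hsum : Summable fun n => pathMultilinear I (p n) fun _ => α := by
      refine .of_norm ((p.summable_norm_mul_pow hrad).of_nonneg_of_le
        (fun n => norm_nonneg _) fun n => ?_)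
      refine (ContinuousMultilinearMap.le_opNorm _ _).trans ?_
      rw [Finset.prod_const, Finset.card_univ, Fintype.card_fin]
      gcongr
      exact norm_pathMultilinear_le _
    suffices superposition f (ContinuousMap.const I x + α) =
        ∑' n, pathMultilinear I (p n) fun _ => α from this ▸ hsum.hasSum
    ext s
    have hc (s : I) : ContinuousAt f ((ContinuousMap.const I x + α) s) := by
      refine hp.continuousOn.continuousAt (Metric.isOpen_eball.mem_nhds ?_)
      have := hs s
      simp only [Metric.mem_eball, edist_zero_right] at this
      simpa [edist_eq_enorm_sub] using this
    rw [superposition_apply hc]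
    exact (hp.hasSum (hs s)).unique
      (hsum.hasSum.map (ContinuousMap.evalCLM 𝕂 s) (ContinuousMap.evalCLM 𝕂 s).continuous)

theorem eventually_contDiffAt_superposition (r : Regularity) {E F : Type u} [NormedAddCommGroup E]
    [NormedSpace 𝕂 E] [NormedAddCommGroup F] [NormedSpace 𝕂 F] [CompleteSpace F] {f : E → F} {x : E}
    (hf : ∀ᶠ y in 𝓝 x, ContDiffAt 𝕂 r.order f y) :
    ∀ᶠ α in 𝓝 (ContinuousMap.const I x),
      ContDiffAt 𝕂 r.order (superposition (I := I) f) α := by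
  cases r with
  | smooth =>
    obtain ⟨U, hU, hUo, hx⟩ := eventually_nhds_iff.1 hf
    have := contDiffOn_superposition (I := I) (𝕂 := 𝕂) hUo
      fun y hy => (hU y hy).contDiffWithinAt
    filter_upwards [(isOpen_paths hUo).mem_nhds (show ContinuousMap.const I x ∈ _ from
      fun s => hx)] with α hα
    exact this.contDiffAt ((isOpen_paths hUo).mem_nhds hα)
  | analytic =>
    have := analyticAt_superposition (I := I) hf.self_of_nhds.analyticAt
    exact this.eventually_analyticAt.mono fun α h => h.contDiffAt

end Smooth

end Superposition

/-! ### Regularity classes and the inverse function theorem. -/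

theorem Regularity.order_ne_zero (r : Regularity) : r.order ≠ 0 := by
  cases r <;> simp [Regularity.order]

theorem Regularity.coe_le_order (r : Regularity) (n : ℕ) : (n : WithTop ℕ∞) ≤ r.order := by
  cases r
  · exact WithTop.coe_le_coe.2 le_top
  · exact le_top

theorem Regularity.one_le_order (r : Regularity) : 1 ≤ r.order := by
  simpa using r.coe_le_order 1

theorem Regularity.infty_le_order (r : Regularity) : ∞ ≤ r.order := by
  cases r
  · exact le_rfl
  · exact le_top

/-- Invertibility of the derivative is an open condition, so the inverse is regular on a whole
neighbourhood. Regularity at the single point would not suffice, since `ContDiffAt` of order `∞`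
provides neighbourhoods depending on the finite order. -/
theorem exists_smooth_local_inverse {𝕂 : Type*} [RCLike 𝕂] (r : Regularity) {E F : Type*}
    [NormedAddCommGroup E] [NormedSpace 𝕂 E] [CompleteSpace E] [NormedAddCommGroup F]
    [NormedSpace 𝕂 F] {G : E → F} {a : E}
    (hG : ∀ᶠ x in 𝓝 a, ContDiffAt 𝕂 r.order G x) (G' : E ≃L[𝕂] F)
    (hG' : HasFDerivAt G (G' : E →L[𝕂] F) a) :
    ∃ χ : F → E, χ (G a) = a ∧ (∀ᶠ y in 𝓝 (G a), ContDiffAt 𝕂 r.order χ y) ∧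
      (∀ᶠ x in 𝓝 a, χ (G x) = x) ∧ ∀ᶠ y in 𝓝 (G a), G (χ y) = y := by
  have h0 := hG.self_of_nhds
  set e := h0.toOpenPartialHomeomorph G hG' r.order_ne_zero with he
  have hes : a ∈ e.source := h0.mem_toOpenPartialHomeomorph_source hG' r.order_ne_zero
  have heG : (e : E → F) = G := rfl
  have ht : G a ∈ e.target := e.map_source hes
  have hχ : e.symm (G a) = a := e.left_inv hes
  have hcont : Tendsto e.symm (𝓝 (G a)) (𝓝 a) := by
    simpa [hχ, ContinuousAt] using e.continuousAt_symm ht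
  have hfd : ContinuousAt (fderiv 𝕂 G) a :=
    (h0.fderiv_right r.order_add_one).continuousAt
  have hinv : ∀ᶠ x in 𝓝 a, fderiv 𝕂 G x ∈ range ((↑) : (E ≃L[𝕂] F) → E →L[𝕂] F) := by
    refine hfd.eventually_mem ?_
    rw [hG'.fderiv]
    exact ContinuousLinearEquiv.nhds G'
  refine ⟨e.symm, hχ, ?_, ?_, ?_⟩
  · filter_upwards [e.open_target.mem_nhds ht, hcont.eventually hG, hcont.eventually hinv]
      with y hy h1 ⟨A, hA⟩
    refine e.contDiffAt_symm hy (f₀' := A) ?_ h1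
    rw [hA]
    exact (h1.differentiableAt r.order_ne_zero).hasFDerivAt
  · filter_upwards [e.open_source.mem_nhds hes] with x hx using e.left_inv hx
  · filter_upwards [e.open_target.mem_nhds ht] with y hy using e.right_inv hy

/-! ### Uniqueness of integral curves. -/

section Uniqueness

variable {E : Type*} [NormedAddCommGroup E] [NormedSpace ℝ E]

theorem eventuallyEq_of_hasDerivAt {v : E → E} {γ γ' : ℝ → E} {t₀ : ℝ}
    (hv : ContDiffAt ℝ 1 v (γ t₀)) (hγ : ∀ᶠ t in 𝓝 t₀, HasDerivAt γ (v (γ t)) t)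
    (hγ' : ∀ᶠ t in 𝓝 t₀, HasDerivAt γ' (v (γ' t)) t) (h : γ t₀ = γ' t₀) : γ =ᶠ[𝓝 t₀] γ' := by
  obtain ⟨K, s, hs, hK⟩ := hv.exists_lipschitzOnWith
  refine ODE_solution_unique_of_eventually (v := fun _ => v) (s := fun _ => s) (K := K)
    (Eventually.of_forall fun _ => hK) ?_ ?_ h
  · exact hγ.and (hγ.self_of_nhds.continuousAt.eventually_mem hs)
  · exact hγ'.and (hγ'.self_of_nhds.continuousAt.eventually_mem (h ▸ hs))

/-- The times near which the curves agree form an open set. It is relatively closed because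
agreement passes to limits and local uniqueness then applies at the limit time. -/
theorem eqOn_of_hasDerivAt {v : E → E} {s : Set ℝ} (hs : IsOpen s) (hs' : IsPreconnected s)
    {γ γ' : ℝ → E} (hv : ∀ t ∈ s, ContDiffAt ℝ 1 v (γ t))
    (hγ : ∀ t ∈ s, HasDerivAt γ (v (γ t)) t) (hγ' : ∀ t ∈ s, HasDerivAt γ' (v (γ' t)) t)
    {t₀ : ℝ} (ht₀ : t₀ ∈ s) (h : γ t₀ = γ' t₀) : EqOn γ γ' s := by
  have hsub : s ⊆ {t | γ =ᶠ[𝓝 t] γ'} := by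
    refine hs'.subset_of_closure_inter_subset ?_ ⟨t₀, ht₀, ?_⟩ ?_
    · refine isOpen_iff_mem_nhds.2 fun t ht => ?_
      exact eventually_eventually_nhds.2 ht
    · exact eventuallyEq_of_hasDerivAt (hv _ ht₀) (eventually_of_mem (hs.mem_nhds ht₀) hγ)
        (eventually_of_mem (hs.mem_nhds ht₀) hγ') h
    · rintro t ⟨hcl, hts⟩
      simp only [mem_ofPred_eq]
      refine eventuallyEq_of_hasDerivAt (hv _ hts) (eventually_of_mem (hs.mem_nhds hts) hγ)
        (eventually_of_mem (hs.mem_nhds hts) hγ') ?_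
      by_contra hne
      have h1 : ∀ᶠ u in 𝓝 t, γ u ≠ γ' u :=
        ((hγ t hts).continuousAt.prodMk (hγ' t hts).continuousAt).eventually
          (isClosed_diagonal.isOpen_compl.eventually_mem (x := (γ t, γ' t)) hne)
      obtain ⟨u, hu, hu'⟩ := mem_closure_iff_nhds.1 hcl _ h1
      exact hu hu'.self_of_nhds
  exact fun t ht => (hsub ht).self_of_nhds

end Uniqueness

/-! ### Integration, linear paths and constant paths as bounded operators. -/

section Integral

variable (𝕂 : Type*) [RCLike 𝕂] (E : Type*) [NormedAddCommGroup E] [NormedSpace 𝕂 E]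
  [NormedSpace ℝ E] [IsScalarTower ℝ 𝕂 E]

/-- The antiderivative of a path on the unit interval, as an operator on paths. -/
noncomputable def pathIntegral : C(unitInterval, E) →L[𝕂] C(unitInterval, E) :=
  have hi (α : C(unitInterval, E)) (a b : ℝ) :
      IntervalIntegrable (IccExtend zero_le_one α) MeasureTheory.volume a b :=
    (α.continuous.Icc_extend').intervalIntegrable _ _
  LinearMap.mkContinuous
    { toFun := fun α => ⟨fun s => ∫ u in (0 : ℝ)..s, IccExtend zero_le_one α u,
        (intervalIntegral.continuous_primitive (hi α) 0).comp continuous_subtype_val⟩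
      map_add' := fun α β => by
        ext s
        simpa [IccExtend] using intervalIntegral.integral_add (hi α 0 s) (hi β 0 s)
      map_smul' := fun c α => by
        ext s
        exact intervalIntegral.integral_smul c _ }
    1 (fun α => by
      rw [ContinuousMap.norm_le _ (by positivity)]
      intro s
      refine (intervalIntegral.norm_integral_le_of_norm_le_const
        (C := ‖α‖) fun u _ => α.norm_coe_le_norm _).trans ?_
      rw [one_mul, sub_zero, abs_of_nonneg s.2.1]
      exact mul_le_of_le_one_right (norm_nonneg _) s.2.2)

theorem pathIntegral_apply (α : C(unitInterval, E)) (s : unitInterval) :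
    pathIntegral 𝕂 E α s = ∫ u in (0 : ℝ)..s, IccExtend zero_le_one α u := rfl

variable {E} in
/-- The linear path `s ↦ s • x`. -/
noncomputable def linearPath : E →L[𝕂] C(unitInterval, E) :=
  LinearMap.mkContinuous
    { toFun := fun x => ⟨fun s => (s : ℝ) • x, by fun_prop⟩
      map_add' := fun x y => by ext; simp
      map_smul' := fun c x => by
        ext s
        exact smul_comm _ _ _ }
    1 (fun x => by
      rw [ContinuousMap.norm_le _ (by positivity)]
      intro s
      simp only [LinearMap.coe_mk, AddHom.coe_mk, ContinuousMap.coe_mk, norm_smul]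
      gcongr
      rw [Real.norm_of_nonneg s.2.1]
      exact s.2.2)

variable {E} in
/-- The constant paths. -/
noncomputable def constPath : E →L[𝕂] C(unitInterval, E) :=
  LinearMap.mkContinuous
    { toFun := fun x => ContinuousMap.const _ x
      map_add' := fun x y => by ext; simp
      map_smul' := fun c x => by ext; simp }
    1 (fun x => by
      rw [ContinuousMap.norm_le _ (by positivity)]
      intro s
      simp)

end Integral

/-! ### Hadamard's lemma. -/

section Hadamard

universe u

/-- Take `g x = ∫₀¹ Df(s x) ds`. It is a bounded linear image of the superposition of `Df` with the
ray through `x`, which gives its regularity in all categories without differentiating under the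
integral. -/
theorem hadamard {𝕂 : Type*} [RCLike 𝕂] (r : Regularity) {E F : Type u} [NormedAddCommGroup E]
    [NormedSpace 𝕂 E] [NormedSpace ℝ E] [IsScalarTower ℝ 𝕂 E] [NormedAddCommGroup F]
    [NormedSpace 𝕂 F] [NormedSpace ℝ F] [IsScalarTower ℝ 𝕂 F] [CompleteSpace F] {f : E → F}
    (hf : ∀ᶠ x in 𝓝 (0 : E), ContDiffAt 𝕂 r.order f x) :
    ∃ g : E → E →L[𝕂] F, (∀ᶠ x in 𝓝 (0 : E), ContDiffAt 𝕂 r.order g x) ∧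
      ∀ᶠ x in 𝓝 (0 : E), f x = f 0 + g x x := by
  let ev : C(unitInterval, E →L[𝕂] F) →L[𝕂] E →L[𝕂] F :=
    (ContinuousMap.evalCLM 𝕂 (1 : unitInterval)).comp (pathIntegral 𝕂 (E →L[𝕂] F))
  let g : E → E →L[𝕂] F := fun x => ev (superposition (fderiv 𝕂 f) (linearPath 𝕂 x))
  have hf' : ∀ᶠ x in 𝓝 (0 : E), ContDiffAt 𝕂 r.order (fderiv 𝕂 f) x :=
    hf.mono fun x hx => hx.fderiv_right r.order_add_one
  refine ⟨g, ?_, ?_⟩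
  · have h1 := eventually_contDiffAt_superposition (I := unitInterval) r hf'
    have h2 : Tendsto (linearPath 𝕂 (E := E)) (𝓝 0) (𝓝 (ContinuousMap.const _ 0)) := by
      have := (linearPath 𝕂 (E := E)).continuous.tendsto 0
      rw [map_zero] at this
      exact this
    filter_upwards [h2.eventually h1] with x hx
    exact ev.contDiff.contDiffAt.comp x (hx.comp x (linearPath 𝕂 (E := E)).contDiff.contDiffAt)
  · obtain ⟨δ, hδ, hB⟩ := Metric.eventually_nhds_iff_ball.1 (hf.and hf')
    filter_upwards [Metric.ball_mem_nhds 0 hδ] with x hx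
    have hmem (s : ℝ) (h0 : 0 ≤ s) (h1 : s ≤ 1) : s • x ∈ Metric.ball (0 : E) δ := by
      rw [mem_ball_zero_iff] at hx ⊢
      rw [norm_smul, Real.norm_of_nonneg h0]
      exact (mul_le_of_le_one_left (norm_nonneg _) h1).trans_lt hx
    have hpath (s : unitInterval) :
        superposition (fderiv 𝕂 f) (linearPath 𝕂 x) s = fderiv 𝕂 f ((s : ℝ) • x) :=
      superposition_apply (f := fderiv 𝕂 f) (α := linearPath 𝕂 x)
        (fun s => (hB _ (hmem s s.2.1 s.2.2)).2.continuousAt) s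
    have hint : IntervalIntegrable
        (IccExtend zero_le_one (superposition (fderiv 𝕂 f) (linearPath 𝕂 x)))
        MeasureTheory.volume 0 1 :=
      ((ContinuousMap.continuous _).Icc_extend').intervalIntegrable _ _
    have hval : g x x = ∫ s in (0 : ℝ)..1,
        (IccExtend zero_le_one (superposition (fderiv 𝕂 f) (linearPath 𝕂 x)) s) x := by
      rw [← ContinuousLinearMap.intervalIntegral_apply hint]
      rfl
    have hftc := intervalIntegral.integral_eq_sub_of_hasDerivAt (f := fun s : ℝ => f (s • x))
      (f' := fun s => (IccExtend zero_le_one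
        (superposition (fderiv 𝕂 f) (linearPath 𝕂 x)) s) x) (a := 0) (b := 1) ?_ ?_
    · rw [hval, hftc]; simp
    · intro s hs
      rw [uIcc_of_le zero_le_one] at hs
      rw [IccExtend_of_mem _ _ hs, hpath]
      have h1 := ((hB _ (hmem s hs.1 hs.2)).1.differentiableAt
        r.order_ne_zero).hasFDerivAt.restrictScalars ℝ
      have h2 : HasDerivAt (fun s : ℝ => s • x) x s := by
        simpa using (hasDerivAt_id s).smul_const x
      exact h1.comp_hasDerivAt s h2
    · refine Continuous.intervalIntegrable ?_ _ _
      exact ((ContinuousMap.continuous _).Icc_extend').clm_apply continuous_const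

end Hadamard

/-! ### Existence of flows with regular dependence on time and initial value. -/

section Flow

variable {𝕂 : Type*} [RCLike 𝕂] {E : Type*} [NormedAddCommGroup E] [NormedSpace 𝕂 E]
  [NormedSpace ℝ E] [IsScalarTower ℝ 𝕂 E] [CompleteSpace E]

/-- The map whose zeros in the last component are the solutions of the integral equation
`α s = x + τ ∫₀ˢ f (α u) du`. -/
noncomputable def picardDefect (𝕂 : Type*) [RCLike 𝕂] {E : Type*} [NormedAddCommGroup E]
    [NormedSpace 𝕂 E] [NormedSpace ℝ E] [IsScalarTower ℝ 𝕂 E] (f : E → E)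
    (z : (𝕂 × E) × C(unitInterval, E)) : (𝕂 × E) × C(unitInterval, E) :=
  (z.1, z.2 - constPath 𝕂 z.1.2 - z.1.1 • pathIntegral 𝕂 E (superposition f z.2))

omit [NormedSpace ℝ E] [IsScalarTower ℝ 𝕂 E] [CompleteSpace E] in
theorem constPath_apply (x : E) (s : unitInterval) : constPath 𝕂 x s = x := rfl

/-- The solutions of the integral equation depend smoothly on the initial value and on the
length of the time interval. -/
theorem exists_smooth_solution (r : Regularity) {f : E → E} {x₀ : E}
    (hf : ∀ᶠ x in 𝓝 x₀, ContDiffAt 𝕂 r.order f x) :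
    ∃ χ : (𝕂 × E) × C(unitInterval, E) → (𝕂 × E) × C(unitInterval, E),
      χ ((0, x₀), 0) = ((0, x₀), constPath 𝕂 x₀) ∧
      (∀ᶠ w in 𝓝 ((0, x₀), 0), ContDiffAt 𝕂 r.order χ w) ∧
      (∀ᶠ z in 𝓝 ((0, x₀), constPath 𝕂 x₀), χ (picardDefect 𝕂 f z) = z) ∧
      ∀ᶠ w in 𝓝 ((0, x₀), 0), picardDefect 𝕂 f (χ w) = w := by
  set a : (𝕂 × E) × C(unitInterval, E) := ((0, x₀), constPath 𝕂 x₀) with ha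
  have hsup := eventually_contDiffAt_superposition (I := unitInterval) r hf
  have hG : ∀ᶠ z in 𝓝 a, ContDiffAt 𝕂 r.order (picardDefect 𝕂 f) z := by
    have h1 : Tendsto (fun z : (𝕂 × E) × C(unitInterval, E) => z.2) (𝓝 a)
        (𝓝 (ContinuousMap.const _ x₀)) := continuous_snd.tendsto a
    filter_upwards [h1.eventually hsup] with z hz
    have h2 : ContDiffAt 𝕂 r.order
        (fun z : (𝕂 × E) × C(unitInterval, E) => superposition f z.2) z := hz.comp z contDiffAt_snd
    refine contDiffAt_fst.prodMk ((contDiffAt_snd.sub ?_).sub (ContDiffAt.fun_smul ?_ ?_))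
    · exact (constPath 𝕂).contDiff.contDiffAt.comp z contDiffAt_fst.snd
    · exact contDiffAt_fst.fst
    · exact (pathIntegral 𝕂 E).contDiff.contDiffAt.comp z h2
  set w := pathIntegral 𝕂 E (superposition f (constPath 𝕂 x₀)) with hw
  let P : 𝕂 × E →L[𝕂] C(unitInterval, E) :=
    (constPath 𝕂).comp (.snd 𝕂 𝕂 E) + (ContinuousLinearMap.fst 𝕂 𝕂 E).smulRight w
  let L (Q : 𝕂 × E →L[𝕂] C(unitInterval, E)) :
      (𝕂 × E) × C(unitInterval, E) →L[𝕂] (𝕂 × E) × C(unitInterval, E) :=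
    (ContinuousLinearMap.fst 𝕂 _ _).prod (.snd 𝕂 _ _ - Q.comp (.fst 𝕂 _ _))
  -- At `τ = 0` the derivative of the superposition operator drops out. What remains is unipotent
  -- triangular, so changing the sign of the off-diagonal part inverts it.
  let G' := ContinuousLinearEquiv.equivOfInverse (L P) (L (-P)) (fun z => by simp [L])
    (fun z => by simp [L])
  have hG' : HasFDerivAt (picardDefect 𝕂 f) (G' : _ →L[𝕂] _) a := by
    have h1 : HasFDerivAt (fun z : (𝕂 × E) × C(unitInterval, E) => z.1.1)
        ((ContinuousLinearMap.fst 𝕂 𝕂 E).comp (.fst 𝕂 _ _)) a :=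
      ((ContinuousLinearMap.fst 𝕂 𝕂 E).comp
        (.fst 𝕂 (𝕂 × E) C(unitInterval, E))).hasFDerivAt
    have h2 : DifferentiableAt 𝕂
        (fun z : (𝕂 × E) × C(unitInterval, E) => pathIntegral 𝕂 E (superposition f z.2)) a := by
      have h3 : DifferentiableAt 𝕂 (superposition (I := unitInterval) f) a.2 :=
        hsup.self_of_nhds.differentiableAt r.order_ne_zero
      exact (pathIntegral 𝕂 E).differentiableAt.comp a (h3.comp a differentiableAt_snd)
    have h3 := h1.smul h2.hasFDerivAt
    have h4 : HasFDerivAt (fun z : (𝕂 × E) × C(unitInterval, E) => z.2 - constPath 𝕂 z.1.2)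
        (.snd 𝕂 _ _ - ((constPath 𝕂).comp (.snd 𝕂 𝕂 E)).comp (.fst 𝕂 _ _)) a :=
      (ContinuousLinearMap.snd 𝕂 _ _ -
        ((constPath 𝕂).comp (.snd 𝕂 𝕂 E)).comp (.fst 𝕂 _ _)).hasFDerivAt
    have h5 := hasFDerivAt_fst.prodMk (h4.sub h3)
    refine h5.congr_fderiv ?_
    ext z <;> simp [G', L, P, a, hw]
  have hGa : picardDefect 𝕂 f a = ((0, x₀), 0) := by simp [picardDefect, a]
  obtain ⟨χ, h1, h2, h3, h4⟩ := exists_smooth_local_inverse r hG G' hG'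
  rw [hGa] at h1 h2 h4
  exact ⟨χ, h1, h2, h3, h4⟩

end Flow

section Flow

variable {𝕂 : Type*} [RCLike 𝕂] {E : Type*} [NormedAddCommGroup E] [NormedSpace 𝕂 E]
  [NormedSpace ℝ E] [IsScalarTower ℝ 𝕂 E]

/-- The path `s ↦ α (u s)`. -/
def rescale (α : C(unitInterval, E)) (u : unitInterval) : C(unitInterval, E) :=
  ⟨fun s => α (u * s), by fun_prop⟩

-- The substitution `v ↦ u v`. It shows that rescaling a solution of the integral equation for the
-- time `τ` solves the one for `u τ`.
omit [NormedSpace 𝕂 E] [IsScalarTower ℝ 𝕂 E] in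
theorem integral_rescale (α : C(unitInterval, E)) (u s : unitInterval) :
    (u : ℝ) • ∫ v in (0 : ℝ)..s, IccExtend zero_le_one (rescale α u) v =
      ∫ v in (0 : ℝ)..(u * s : unitInterval), IccExtend zero_le_one α v := by
  have h := intervalIntegral.smul_integral_comp_mul_left (a := 0) (b := s)
    (IccExtend zero_le_one α) (u : ℝ)
  rw [mul_zero] at h
  rw [show ((u * s : unitInterval) : ℝ) = u * s from rfl, ← h]
  congr 1
  refine intervalIntegral.integral_congr fun v hv => ?_
  rw [uIcc_of_le s.2.1] at hv
  have hv1 : v ∈ Icc (0 : ℝ) 1 := ⟨hv.1, hv.2.trans s.2.2⟩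
  simp only [IccExtend_of_mem _ _ hv1,
    IccExtend_of_mem _ α (unitInterval.mul_mem u.2 hv1)]
  rfl

/-- A local flow of a smooth vector field `f`: it is jointly smooth over `𝕂`, and restricts to the
integral curves of `f` for real times. -/
theorem exists_smooth_flow [CompleteSpace E] (r : Regularity) {f : E → E} {x₀ : E}
    (hf : ∀ᶠ x in 𝓝 x₀, ContDiffAt 𝕂 r.order f x) :
    ∃ Φ : 𝕂 × E → E, (∀ᶠ z in 𝓝 (0, x₀), ContDiffAt 𝕂 r.order Φ z) ∧
      (∀ᶠ x in 𝓝 x₀, Φ (0, x) = x) ∧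
      ∀ᶠ z : ℝ × E in 𝓝 (0, x₀),
        HasDerivAt (fun s : ℝ => Φ ((s : 𝕂), z.2)) (f (Φ ((z.1 : 𝕂), z.2))) z.1 := by
  obtain ⟨χ, hχ0, hχs, hχl, hχr⟩ := exists_smooth_solution r hf
  let A : 𝕂 × E → C(unitInterval, E) := fun z => (χ (z, 0)).2
  let ev : C(unitInterval, E) →L[𝕂] E := ContinuousMap.evalCLM 𝕂 1
  obtain ⟨U, hU, hUo, hxU⟩ := eventually_nhds_iff.1 hf
  have hι : Tendsto (fun z : 𝕂 × E => (z, (0 : C(unitInterval, E)))) (𝓝 (0, x₀))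
      (𝓝 ((0, x₀), 0)) := (by fun_prop : Continuous _).tendsto _
  have hA0 : A (0, x₀) = constPath 𝕂 x₀ := congrArg Prod.snd hχ0
  have hAs : ∀ᶠ z in 𝓝 ((0, x₀) : 𝕂 × E), ContDiffAt 𝕂 r.order A z :=
    (hι.eventually hχs).mono fun z hz => contDiffAt_snd.comp z
      (hz.comp z (contDiffAt_id.prodMk contDiffAt_const))
  have hAt : Tendsto A (𝓝 (0, x₀)) (𝓝 (constPath 𝕂 x₀)) :=
    hA0 ▸ hAs.self_of_nhds.continuousAt
  have hAr : ∀ᶠ z in 𝓝 ((0, x₀) : 𝕂 × E), ∀ s : unitInterval, A z s = z.2 +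
      z.1 • ∫ v in (0 : ℝ)..s, IccExtend zero_le_one (superposition f (A z)) v := by
    filter_upwards [hι.eventually hχr] with z hz s
    have h1 : (χ (z, 0)).1 = z := congrArg Prod.fst hz
    have h2 := congrArg (fun w => w.2 s) hz
    simp only [picardDefect, h1, ContinuousMap.sub_apply, ContinuousMap.smul_apply,
      constPath_apply, pathIntegral_apply, ContinuousMap.zero_apply] at h2
    rw [sub_sub, sub_eq_zero] at h2
    exact h2
  have hAU : ∀ᶠ z in 𝓝 ((0, x₀) : 𝕂 × E), ∀ s, A z s ∈ U :=
    hAt.eventually ((isOpen_paths hUo).mem_nhds fun s => hxU)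
  obtain ⟨ρ, hρ, hρ'⟩ := Metric.eventually_nhds_iff_ball.1 hχl
  obtain ⟨δ, hδ, hB⟩ := Metric.eventually_nhds_iff_ball.1 (hAs.and (hAr.and (hAU.and
    ((hAt.eventually (Metric.ball_mem_nhds _ hρ)).and (Metric.ball_mem_nhds (0, x₀) hρ)))))
  -- The flow will be the endpoint of the solution path. A rescaled solution solves the equation for
  -- the shorter time, and the local left inverse `χ` makes solutions unique, so the endpoint for
  -- time `u τ` is the value at `u` of the path for `τ`.
  have hscale (z : 𝕂 × E) (hz : z ∈ Metric.ball (0, x₀) δ) (u : unitInterval) :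
      A (((u : ℝ) : 𝕂) * z.1, z.2) 1 = A z u := by
    obtain ⟨h1, h2, h3, h4, h5⟩ := hB z hz
    have hsup : superposition f (rescale (A z) u) = rescale (superposition f (A z)) u := by
      ext s
      rw [superposition_apply fun s => (hU _ (h3 (u * s))).continuousAt]
      exact (superposition_apply (fun s => (hU _ (h3 s)).continuousAt) (u * s)).symm
    have hdef : picardDefect 𝕂 f ((((u : ℝ) : 𝕂) * z.1, z.2), rescale (A z) u) =
        ((((u : ℝ) : 𝕂) * z.1, z.2), 0) := by
      refine Prod.ext rfl (ContinuousMap.ext fun s => ?_)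
      simp only [picardDefect, ContinuousMap.sub_apply, ContinuousMap.smul_apply,
        constPath_apply, pathIntegral_apply, ContinuousMap.zero_apply]
      rw [hsup, mul_comm, mul_smul, ← RCLike.real_smul_eq_coe_smul (K := 𝕂) (u : ℝ),
        integral_rescale, sub_sub, sub_eq_zero]
      exact h2 (u * s)
    have hmem : ((((u : ℝ) : 𝕂) * z.1, z.2), rescale (A z) u) ∈
        Metric.ball ((0, x₀), constPath 𝕂 x₀) ρ := by
      rw [Metric.mem_ball, Prod.dist_eq, Prod.dist_eq] at *
      simp only [dist_zero_right, max_lt_iff] at *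
      refine ⟨⟨?_, h5.2⟩, ?_⟩
      · rw [norm_mul, RCLike.norm_ofReal, abs_of_nonneg u.2.1]
        exact (mul_le_of_le_one_left (norm_nonneg _) u.2.2).trans_lt h5.1
      · refine lt_of_le_of_lt ((ContinuousMap.dist_le dist_nonneg).2 fun s => ?_) h4
        exact ContinuousMap.dist_apply_le_dist (f := A z) (g := constPath 𝕂 x₀) (u * s)
    have h6 := hρ' _ hmem
    rw [hdef] at h6
    have h7 := congrArg (fun w => w.2 1) h6
    simpa [A, rescale] using h7
  -- By `hscale` the integral equation for paths becomes one for their endpoints in real time, which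
  -- can be differentiated.
  have hΦ (z : ℝ × E) (hz : ((z.1 : 𝕂), z.2) ∈ Metric.ball ((0, x₀) : 𝕂 × E) δ) :
      ev (A ((z.1 : 𝕂), z.2)) = z.2 + ∫ v in (0 : ℝ)..z.1, f (ev (A ((v : 𝕂), z.2))) := by
    obtain ⟨h1, h2, h3, h4, h5⟩ := hB _ hz
    have h6 := intervalIntegral.smul_integral_comp_mul_right (a := 0) (b := 1)
      (fun v : ℝ => f (ev (A ((v : 𝕂), z.2)))) z.1
    rw [zero_mul, one_mul] at h6
    rw [← h6]
    refine (h2 1).trans ?_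
    rw [RCLike.real_smul_eq_coe_smul (K := 𝕂) z.1]
    congr 2
    refine intervalIntegral.integral_congr fun v hv => ?_
    rw [Icc.coe_one, uIcc_of_le zero_le_one] at hv
    simp only [IccExtend_of_mem _ _ hv]
    rw [superposition_apply fun s => (hU _ (h3 s)).continuousAt, ← hscale _ hz ⟨v, hv⟩]
    simp [ev]
  refine ⟨fun z => ev (A z), ?_, ?_, ?_⟩
  · exact hAs.mono fun z hz => ev.contDiff.contDiffAt.comp z hz
  · have h1 : Tendsto (fun x : E => ((0 : 𝕂), x)) (𝓝 x₀) (𝓝 (0, x₀)) :=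
      (by fun_prop : Continuous _).tendsto _
    filter_upwards [h1.eventually hAr] with x hx
    simpa [ev] using hx 1
  · have hc : Continuous fun z : ℝ × E => ((z.1 : 𝕂), z.2) :=
      (RCLike.continuous_ofReal.comp continuous_fst).prodMk continuous_snd
    have h1 : Tendsto (fun z : ℝ × E => ((z.1 : 𝕂), z.2)) (𝓝 (0, x₀)) (𝓝 (0, x₀)) := by
      simpa using hc.tendsto (0, x₀)
    filter_upwards [h1.eventually (Metric.ball_mem_nhds _ hδ)] with z hz
    have hcont (v : ℝ) (hv : ((v : 𝕂), z.2) ∈ Metric.ball ((0, x₀) : 𝕂 × E) δ) :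
        ContinuousAt (fun v : ℝ => f (ev (A ((v : 𝕂), z.2)))) v := by
      obtain ⟨h1, h2, h3, h4, h5⟩ := hB _ hv
      refine ContinuousAt.comp (g := f) (hU _ (h3 1)).continuousAt ?_
      refine ev.continuous.continuousAt.comp (ContinuousAt.comp (g := A) h1.continuousAt ?_)
      exact (hc.comp (Continuous.prodMk_left z.2)).continuousAt
    have hev : ∀ᶠ s : ℝ in 𝓝 z.1, ((s : 𝕂), z.2) ∈ Metric.ball ((0, x₀) : 𝕂 × E) δ :=
      ((hc.comp (Continuous.prodMk_left z.2)).tendsto z.1).eventually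
        (Metric.isOpen_ball.mem_nhds hz)
    have hint := intervalIntegral.integral_hasDerivAt_right (a := 0) (b := z.1)
      (f := fun v : ℝ => f (ev (A ((v : 𝕂), z.2)))) ?_ ?_ (hcont _ hz)
    · refine (hint.const_add z.2).congr_of_eventuallyEq ?_
      filter_upwards [hev] with s hs using hΦ (s, z.2) hs
    · refine ContinuousOn.intervalIntegrable fun v hv => (hcont v ?_).continuousWithinAt
      rw [Metric.mem_ball, Prod.dist_eq] at *
      simp only [dist_zero_right, max_lt_iff, RCLike.norm_ofReal] at *
      refine ⟨lt_of_le_of_lt ?_ hz.1, hz.2⟩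
      simpa using abs_sub_left_of_mem_uIcc hv
    · obtain ⟨s, hs, hso, hzs⟩ := eventually_nhds_iff.1 hev
      exact ContinuousOn.stronglyMeasurableAtFilter hso
        (fun v hv => (hcont v (hs v hv)).continuousWithinAt) _ hzs

end Flow

/-! ### Orbits under local diffeomorphisms preserving a set. -/

section Orbits

variable {E : Type*} [NormedAddCommGroup E] [NormedSpace ℝ E]

/-- The integral curve of `X` through `x` stays, for small times, in `V` or in its complement. -/
def Invariant (X : E → E) (V : Set E) (x : E) : Prop :=
  ∀ c : ℝ → E, c 0 = x → (∀ᶠ s in 𝓝 0, HasDerivAt c (X (c s)) s) →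
    ∀ᶠ s in 𝓝 0, (c s ∈ V ↔ x ∈ V)

/-- Membership in `V` is locally constant along the curve, hence constant on a connected set of
times. -/
theorem Invariant.mem_iff {X : E → E} {V : Set E} {s : Set ℝ} (hs : IsOpen s)
    (hs' : IsPreconnected s) {γ : ℝ → E} (hγ : ∀ t ∈ s, HasDerivAt γ (X (γ t)) t)
    (hX : ∀ t ∈ s, Invariant X V (γ t)) {t₀ t₁ : ℝ} (h₀ : t₀ ∈ s) (h₁ : t₁ ∈ s) :
    γ t₀ ∈ V ↔ γ t₁ ∈ V := by
  refine hs'.induction₂ (fun a b => γ a ∈ V ↔ γ b ∈ V) (fun t ht => ?_)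
    (fun a b c _ _ _ h1 h2 => h1.trans h2) (fun a b _ _ h => h.symm) h₀ h₁
  have h1 : Tendsto (fun u : ℝ => t + u) (𝓝 0) (𝓝 t) := by
    simpa using (continuous_const_add t).tendsto 0
  have h2 := hX t ht (fun u => γ (t + u)) (by simp) (by
    filter_upwards [h1.eventually (hs.mem_nhds ht)] with u hu
    exact (hγ _ hu).comp_const_add t u)
  have h3 : Tendsto (fun u : ℝ => u - t) (𝓝 t) (𝓝 0) := by
    simpa using (continuous_sub_right t).tendsto t
  refine nhdsWithin_le_nhds ?_
  filter_upwards [h3.eventually h2] with u hu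
  simpa [iff_comm] using hu

/-- There is a local diffeomorphism mapping `y` to `x` and preserving `V`. -/
def LocallyEquivalent (V : Set E) (y x : E) : Prop :=
  ∃ g : E → E, g y = x ∧ (∀ᶠ z in 𝓝 y, ContDiffAt ℝ ∞ g z) ∧
    (∃ G : E ≃L[ℝ] E, HasFDerivAt g (G : E →L[ℝ] E) y) ∧ ∀ᶠ z in 𝓝 y, (g z ∈ V ↔ z ∈ V)

namespace LocallyEquivalent

variable {V : Set E} {x y z : E}

theorem refl (x : E) : LocallyEquivalent V x x :=
  ⟨id, rfl, .of_forall fun _ => contDiffAt_id, ⟨.refl ℝ E, hasFDerivAt_id x⟩, .of_forall fun _ =>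
    Iff.rfl⟩

theorem mem_iff (h : LocallyEquivalent V y x) : x ∈ V ↔ y ∈ V := by
  obtain ⟨g, rfl, -, -, h⟩ := h
  exact h.self_of_nhds

theorem trans (h1 : LocallyEquivalent V z y) (h2 : LocallyEquivalent V y x) :
    LocallyEquivalent V z x := by
  obtain ⟨g, rfl, hgs, ⟨G, hG⟩, hgV⟩ := h1
  obtain ⟨f, rfl, hfs, ⟨F, hF⟩, hfV⟩ := h2
  have ht := hG.continuousAt.tendsto
  refine ⟨f ∘ g, rfl, ?_, ⟨G.trans F, hF.comp z hG⟩, ?_⟩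
  · filter_upwards [hgs, ht.eventually hfs] with w h1 h2 using h2.comp w h1
  · filter_upwards [hgV, ht.eventually hfV] with w h1 h2 using h2.trans h1

theorem symm [CompleteSpace E] (h : LocallyEquivalent V y x) : LocallyEquivalent V x y := by
  obtain ⟨g, rfl, hgs, ⟨G, hG⟩, hgV⟩ := h
  obtain ⟨χ, h1, h2, h3, h4⟩ := exists_smooth_local_inverse .smooth hgs G hG
  have ht : Tendsto χ (𝓝 (g y)) (𝓝 y) := by
    simpa [ContinuousAt, h1] using h2.self_of_nhds.continuousAt
  refine ⟨χ, h1, h2, ⟨G.symm, ?_⟩, ?_⟩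
  · exact HasFDerivAt.of_local_left_inverse h2.self_of_nhds.continuousAt (by rwa [h1]) h4
  · filter_upwards [h4, ht.eventually hgV] with w hw hw'
    rw [← hw', hw]

end LocallyEquivalent

/-- The same `g` serves at all nearby points, since invertibility of its derivative is open. -/
theorem eventually_locallyEquivalent [CompleteSpace E] {V : Set E} {g : E → E} {y : E}
    (hgs : ∀ᶠ z in 𝓝 y, ContDiffAt ℝ ∞ g z) (G : E ≃L[ℝ] E) (hG : HasFDerivAt g (G : E →L[ℝ] E) y)
    (hgV : ∀ᶠ z in 𝓝 y, (g z ∈ V ↔ z ∈ V)) : ∀ᶠ z in 𝓝 y, LocallyEquivalent V z (g z) := by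
  have hfd : ContinuousAt (fderiv ℝ g) y :=
    (hgs.self_of_nhds.fderiv_right (m := ∞) le_rfl).continuousAt
  have hinv : ∀ᶠ z in 𝓝 y, fderiv ℝ g z ∈ range ((↑) : (E ≃L[ℝ] E) → E →L[ℝ] E) := by
    refine hfd.eventually_mem ?_
    rw [hG.fderiv]
    exact ContinuousLinearEquiv.nhds G
  filter_upwards [hgs.eventually_nhds, hgV.eventually_nhds, hinv] with z h1 h2 ⟨A, hA⟩
  refine ⟨g, rfl, h1, ⟨A, ?_⟩, h2⟩
  rw [hA]
  exact (h1.self_of_nhds.differentiableAt (by simp)).hasFDerivAt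

/-- The flow of a vector field that leaves `V` invariant consists of local diffeomorphisms that
preserve `V`. -/
theorem exists_flow_locallyEquivalent [CompleteSpace E] {X : E → E} {V : Set E} {x₀ : E}
    (hX : ∀ᶠ x in 𝓝 x₀, ContDiffAt ℝ ∞ X x) (hV : ∀ᶠ x in 𝓝 x₀, Invariant X V x) :
    ∃ Φ : ℝ × E → E, (∀ᶠ z in 𝓝 (0, x₀), ContDiffAt ℝ ∞ Φ z) ∧ (∀ᶠ x in 𝓝 x₀, Φ (0, x) = x) ∧
      (∀ᶠ z : ℝ × E in 𝓝 (0, x₀), HasDerivAt (fun s : ℝ => Φ (s, z.2)) (X (Φ z)) z.1) ∧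
      ∀ᶠ z : ℝ × E in 𝓝 (0, x₀), LocallyEquivalent V z.2 (Φ z) := by
  obtain ⟨Φ, h1, h2, h3⟩ := exists_smooth_flow (𝕂 := ℝ) .smooth hX
  simp only [RCLike.ofReal_real_eq_id, id_eq, Prod.mk.eta, Regularity.order] at h1 h3
  refine ⟨Φ, h1, h2, h3, ?_⟩
  have hΦ0 : Φ (0, x₀) = x₀ := h2.self_of_nhds
  have hΦt : Tendsto Φ (𝓝 (0, x₀)) (𝓝 x₀) := by
    simpa [ContinuousAt, hΦ0] using h1.self_of_nhds.continuousAt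
  obtain ⟨δ, hδ, hB⟩ := Metric.eventually_nhds_iff_ball.1 (h3.and (hΦt.eventually hV))
  have hflow : ∀ᶠ z : ℝ × E in 𝓝 (0, x₀), (Φ z ∈ V ↔ z.2 ∈ V) := by
    have h0 : ∀ᶠ z : ℝ × E in 𝓝 (0, x₀), Φ (0, z.2) = z.2 :=
      (continuous_snd.tendsto ((0 : ℝ), x₀)).eventually h2
    filter_upwards [h0, Metric.ball_mem_nhds _ hδ] with z hz0 hz
    have hmem (s : ℝ) (hs : s ∈ Metric.ball (0 : ℝ) δ) :
        (s, z.2) ∈ Metric.ball ((0 : ℝ), x₀) δ := by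
      rw [Metric.mem_ball, Prod.dist_eq, max_lt_iff] at *
      exact ⟨hs, hz.2⟩
    have hz1 : z.1 ∈ Metric.ball (0 : ℝ) δ := by
      rw [Metric.mem_ball, Prod.dist_eq, max_lt_iff] at *
      exact hz.1
    have := Invariant.mem_iff Metric.isOpen_ball (convex_ball (0 : ℝ) δ).isPreconnected
      (γ := fun s => Φ (s, z.2)) (X := X) (V := V) (fun s hs => (hB _ (hmem s hs)).1)
      (fun s hs => (hB _ (hmem s hs)).2) hz1 (Metric.mem_ball_self hδ)
    rwa [hz0] at this
  have hfd : ContinuousAt (fun z => (fderiv ℝ Φ z).comp (.inr ℝ ℝ E)) (0, x₀) :=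
    (h1.self_of_nhds.fderiv_right (m := ∞) le_rfl).continuousAt.clm_comp continuousAt_const
  have hpart : ∀ᶠ z in 𝓝 ((0 : ℝ), x₀), HasFDerivAt (fun x => Φ (z.1, x))
      ((fderiv ℝ Φ z).comp (.inr ℝ ℝ E)) z.2 := by
    filter_upwards [h1] with z hz
    exact (hz.differentiableAt (by simp)).hasFDerivAt.comp z.2 (hasFDerivAt_prodMk_right z.1 z.2)
  -- The time-zero map is the identity, so the spatial derivative is invertible for small times and
  -- nearby points.
  have hid : (fderiv ℝ Φ (0, x₀)).comp (.inr ℝ ℝ E) = ContinuousLinearEquiv.refl ℝ E := by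
    refine hpart.self_of_nhds.unique ((hasFDerivAt_id x₀).congr_of_eventuallyEq ?_)
    exact h2
  have hinv : ∀ᶠ z in 𝓝 ((0 : ℝ), x₀), (fderiv ℝ Φ z).comp (.inr ℝ ℝ E) ∈
      range ((↑) : (E ≃L[ℝ] E) → E →L[ℝ] E) := by
    refine hfd.eventually_mem ?_
    rw [hid]
    exact ContinuousLinearEquiv.nhds _
  filter_upwards [h1.eventually_nhds, hflow.eventually_nhds, hpart, hinv]
    with z hz1 hz2 hz3 ⟨A, hA⟩
  have ht : Tendsto (fun x => (z.1, x)) (𝓝 z.2) (𝓝 z) :=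
    (Continuous.prodMk_right z.1).tendsto z.2
  refine ⟨fun x => Φ (z.1, x), rfl, ?_, ⟨A, hA ▸ hz3⟩, ?_⟩
  · filter_upwards [ht.eventually hz1] with x hx
    exact hx.comp x (contDiffAt_const.prodMk contDiffAt_id)
  · filter_upwards [ht.eventually hz2] with x hx using hx

end Orbits

section Orbits

variable {E : Type*} [NormedAddCommGroup E] [NormedSpace ℝ E]

/-- `H` is a germ of an immersion into the orbit of `x` under local diffeomorphisms
preserving `V`. -/
structure IsPlaque (V : Set E) (x : E) {n : ℕ} (H : (Fin n → ℝ) → E) : Prop where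
  map_zero : H 0 = x
  smooth : ∀ᶠ σ in 𝓝 0, ContDiffAt ℝ ∞ H σ
  injective : Function.Injective (fderiv ℝ H 0)
  equiv : ∀ᶠ σ in 𝓝 0, LocallyEquivalent V (H σ) x

theorem isPlaque_zero (V : Set E) (x : E) : IsPlaque V x (fun _ : Fin 0 → ℝ => x) where
  map_zero := rfl
  smooth := .of_forall fun _ => contDiffAt_const
  injective := Function.injective_of_subsingleton _
  equiv := .of_forall fun _ => .refl x

theorem eventually_injective_fderiv {n : ℕ} {H : (Fin n → ℝ) → E} {σ₀ : Fin n → ℝ}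
    (hs : ContDiffAt ℝ ∞ H σ₀) (hi : Function.Injective (fderiv ℝ H σ₀)) :
    ∀ᶠ σ in 𝓝 σ₀, Function.Injective (fderiv ℝ H σ) := by
  have hc : ContinuousAt (fderiv ℝ H) σ₀ := (hs.fderiv_right (m := ∞) le_rfl).continuousAt
  exact hc.eventually (ContinuousLinearMap.isOpen_injective.mem_nhds hi)

/-- A vector field leaving `V` invariant and transverse to a plaque can be used to produce a plaque
of higher dimension. -/
theorem IsPlaque.exists_succ [CompleteSpace E] {V : Set E} {x₀ : E} {n : ℕ} {H : (Fin n → ℝ) → E}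
    {X : E → E} {σ₁ : Fin n → ℝ} (hs : ∀ᶠ σ in 𝓝 σ₁, ContDiffAt ℝ ∞ H σ)
    (hi : Function.Injective (fderiv ℝ H σ₁))
    (he : ∀ᶠ σ in 𝓝 σ₁, LocallyEquivalent V (H σ) x₀)
    (hX : ∀ᶠ x in 𝓝 (H σ₁), ContDiffAt ℝ ∞ X x) (hV : ∀ᶠ x in 𝓝 (H σ₁), Invariant X V x)
    (hnot : X (H σ₁) ∉ (fderiv ℝ H σ₁).range) :
    ∃ H' : (Fin (n + 1) → ℝ) → E, IsPlaque V x₀ H' := by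
  obtain ⟨Φ, hΦs, hΦ0, hΦd, hΦe⟩ := exists_flow_locallyEquivalent hX hV
  obtain ⟨g, hg0, hgs, ⟨G, hG⟩, hgV⟩ := he.self_of_nhds
  have hge := eventually_locallyEquivalent hgs G hG hgV
  let p : (Fin (n + 1) → ℝ) →L[ℝ] ℝ := .proj 0
  let q : (Fin (n + 1) → ℝ) →L[ℝ] (Fin n → ℝ) := .pi fun i => .proj i.succ
  let B : (Fin (n + 1) → ℝ) → ℝ × E := fun τ => (p τ, H (σ₁ + q τ))
  have hq : Tendsto (fun τ => σ₁ + q τ) (𝓝 0) (𝓝 σ₁) := by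
    exact Continuous.tendsto' (by fun_prop) _ _ (by simp)
  have hBs : ∀ᶠ τ in 𝓝 0, ContDiffAt ℝ ∞ B τ := by
    filter_upwards [hq.eventually hs] with τ hτ
    exact p.contDiff.contDiffAt.prodMk
      (hτ.comp τ (contDiffAt_const.add q.contDiff.contDiffAt))
  have hB0 : B 0 = (0, H σ₁) := by simp [B]
  have hBt : Tendsto B (𝓝 0) (𝓝 (0, H σ₁)) := hB0 ▸ hBs.self_of_nhds.continuousAt
  have hΦB : Φ (0, H σ₁) = H σ₁ := hΦ0.self_of_nhds
  have hΦt : Tendsto Φ (𝓝 (0, H σ₁)) (𝓝 (H σ₁)) := by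
    simpa [ContinuousAt, hΦB] using hΦs.self_of_nhds.continuousAt
  have hBd : HasFDerivAt B (p.prod ((fderiv ℝ H σ₁).comp q)) 0 := by
    refine p.hasFDerivAt.prodMk ?_
    have h1 : HasFDerivAt H (fderiv ℝ H σ₁) (σ₁ + q 0) := by
      simpa using (hs.self_of_nhds.differentiableAt (by simp)).hasFDerivAt
    exact h1.comp (0 : Fin (n + 1) → ℝ) (q.hasFDerivAt.const_add σ₁)
  have hΦfd : HasFDerivAt Φ (fderiv ℝ Φ (0, H σ₁)) (B 0) := by
    rw [hB0]; exact (hΦs.self_of_nhds.differentiableAt (by simp)).hasFDerivAt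
  have hΦ1 : fderiv ℝ Φ (0, H σ₁) (1, 0) = X (H σ₁) := by
    have h1 : HasFDerivAt Φ (fderiv ℝ Φ (0, H σ₁)) (0, H σ₁) := hB0 ▸ hΦfd
    have h2 : HasDerivAt (fun s : ℝ => (s, H σ₁)) (1, 0) 0 :=
      (hasDerivAt_id 0).prodMk (hasDerivAt_const _ _)
    have h3 := hΦd.self_of_nhds
    simp only [hΦB] at h3
    exact (h1.comp_hasDerivAt 0 h2).unique h3
  have hΦ2 (v : E) : fderiv ℝ Φ (0, H σ₁) (0, v) = v := by
    have h1 : HasFDerivAt Φ (fderiv ℝ Φ (0, H σ₁)) (0, H σ₁) := hB0 ▸ hΦfd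
    have h2 := h1.comp (H σ₁) (hasFDerivAt_prodMk_right (𝕜 := ℝ) (0 : ℝ) (H σ₁))
    have h3 : HasFDerivAt (Φ ∘ fun x => ((0 : ℝ), x)) (.id ℝ E) (H σ₁) :=
      (hasFDerivAt_id (H σ₁)).congr_of_eventuallyEq hΦ0
    simpa using congrArg (fun A : E →L[ℝ] E => A v) (h2.unique h3)
  have hGd : HasFDerivAt g (G : E →L[ℝ] E) (Φ (B 0)) := by rw [hB0, hΦB]; exact hG
  -- Flow the old plaque along `X`, then carry its point `H σ₁` back to `x₀` by `g`, so that the new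
  -- plaque is again based at `x₀`. Its derivative at `0` is that of `g` applied to the span of `X
  -- (H σ₁)` and the old tangent space, and is injective by transversality.
  refine ⟨fun τ => g (Φ (B τ)), ?_, ?_, ?_, ?_⟩
  · rw [hB0, hΦB, hg0]
  · filter_upwards [hBs, hBt.eventually hΦs, hBt.eventually (hΦt.eventually hgs)] with τ h1 h2 h3
    exact h3.comp τ (h2.comp τ h1)
  · have hd := hGd.comp 0 (hΦfd.comp 0 hBd)
    have hd' : fderiv ℝ (fun τ => g (Φ (B τ))) 0 = _ := hd.fderiv
    rw [hd']
    refine (injective_iff_map_eq_zero _).2 fun v hv => ?_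
    have h1 : fderiv ℝ Φ (0, H σ₁) (p v, fderiv ℝ H σ₁ (q v)) = 0 := by
      simpa using hv
    have h2 : p v • X (H σ₁) + fderiv ℝ H σ₁ (q v) = 0 := by
      rw [← hΦ1, ← hΦ2 (fderiv ℝ H σ₁ (q v)), ← map_smul, ← map_add]
      simpa using h1
    have hp : p v = 0 := by
      by_contra hp
      refine hnot ⟨-(p v)⁻¹ • q v, ?_⟩
      have h3 : fderiv ℝ H σ₁ (q v) = -(p v • X (H σ₁)) := by
        rw [eq_neg_iff_add_eq_zero, add_comm]; exact h2
      simp [h3, smul_smul, hp]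
    have hqv : q v = 0 := hi (by simpa [hp] using h2)
    ext i
    refine Fin.cases hp (fun j => ?_) i
    exact congrFun hqv j
  · filter_upwards [hq.eventually he, hBt.eventually hΦe,
      hBt.eventually (hΦt.eventually hge)] with τ h1 h2 h3
    exact h3.symm.trans (h2.symm.trans h1)

/-- A smooth vector field which is a pointwise combination of vector fields that leave `V` invariant
leaves `V` invariant. -/
theorem invariant_of_mem_span [FiniteDimensional ℝ E] {ι : Type*} {X : ι → E → E} {Y : E → E}
    {V : Set E} {x₀ : E} (hX : ∀ᶠ x in 𝓝 x₀, ∀ i, ContDiffAt ℝ ∞ (X i) x ∧ Invariant (X i) V x)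
    (hY : ∀ᶠ x in 𝓝 x₀, ContDiffAt ℝ ∞ Y x)
    (hmem : ∀ᶠ x in 𝓝 x₀, Y x ∈ Submodule.span ℝ (range fun i => X i x)) :
    Invariant Y V x₀ := by
  have : CompleteSpace E := FiniteDimensional.complete ℝ E
  -- Plaques are immersed, so their dimension is bounded by that of `E`; take one that cannot be
  -- extended.
  obtain ⟨n, ⟨H, hH⟩, hmax⟩ : ∃ n, (∃ H : (Fin n → ℝ) → E, IsPlaque V x₀ H) ∧
      ¬ ∃ H : (Fin (n + 1) → ℝ) → E, IsPlaque V x₀ H := by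
    by_contra! hcon
    have hall (n : ℕ) : ∃ H : (Fin n → ℝ) → E, IsPlaque V x₀ H := by
      induction n with
      | zero => exact ⟨_, isPlaque_zero V x₀⟩
      | succ n ih => exact hcon n ih
    obtain ⟨H, hH⟩ := hall (Module.finrank ℝ E + 1)
    have := LinearMap.finrank_le_finrank_of_injective
      (f := (fderiv ℝ H 0 : (Fin (Module.finrank ℝ E + 1) → ℝ) →ₗ[ℝ] E)) hH.injective
    simp at this
  have hH0 := hH.smooth.self_of_nhds
  have hHt : Tendsto H (𝓝 0) (𝓝 x₀) := by
    simpa [ContinuousAt, hH.map_zero] using hH0.continuousAt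
  -- By maximality no `X i` is transverse to the plaque at any of its points near `x₀`. Hence the
  -- tangent spaces there contain all `X i`, and with them `Y`.
  have htan : ∀ᶠ σ in 𝓝 0, Y (H σ) ∈ (fderiv ℝ H σ).range := by
    filter_upwards [hH.smooth.eventually_nhds, hH.equiv.eventually_nhds,
      eventually_injective_fderiv hH0 hH.injective, hHt.eventually hX.eventually_nhds,
      hHt.eventually hmem] with σ h1 h2 h3 h4 h5
    refine Submodule.span_le.2 ?_ h5
    rintro _ ⟨i, rfl⟩
    by_contra hnot
    exact hmax (IsPlaque.exists_succ h1 h3 h2 (h4.mono fun x hx => (hx i).1)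
      (h4.mono fun x hx => (hx i).2) hnot)
  obtain ⟨L, hL⟩ := LinearMap.exists_leftInverse_of_injective
    (fderiv ℝ H 0 : (Fin n → ℝ) →ₗ[ℝ] E) (LinearMap.ker_eq_bot.2 hH.injective)
  -- A left inverse `L` of the derivative at `0` makes `T` the identity there and invertible nearby.
  -- Thus `T⁻¹ L` is a left inverse of `fderiv ℝ H σ` depending regularly on `σ`, and `b` lifts `Y`
  -- to a `C¹` field on the parameter space.
  let T : (Fin n → ℝ) → (Fin n → ℝ) →L[ℝ] (Fin n → ℝ) := fun σ =>
    L.toContinuousLinearMap.comp (fderiv ℝ H σ)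
  have hT0 : T 0 = 1 := by
    ext v : 1
    exact LinearMap.congr_fun hL v
  have hTs : ContDiffAt ℝ 1 T 0 :=
    contDiffAt_const.clm_comp (hH0.fderiv_right (m := 1) (WithTop.coe_le_coe.2 le_top))
  have hTu : ∀ᶠ σ in 𝓝 0, IsUnit (T σ) :=
    hTs.continuousAt.eventually_mem (Units.isOpen.mem_nhds (by simp [hT0]))
  let b : (Fin n → ℝ) → Fin n → ℝ := fun σ => Ring.inverse (T σ) (L.toContinuousLinearMap (Y (H σ)))
  have hbs : ContDiffAt ℝ 1 b 0 := by
    have h1 : ContDiffAt ℝ 1 Ring.inverse (T 0) := by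
      rw [hT0]
      exact contDiffAt_ringInverse ℝ (1 : ((Fin n → ℝ) →L[ℝ] (Fin n → ℝ))ˣ)
    have h2 : ContDiffAt ℝ 1 (fun σ => Y (H σ)) 0 := by
      refine ContDiffAt.comp (g := Y) 0 ?_ (hH0.of_le (WithTop.coe_le_coe.2 le_top))
      rw [hH.map_zero]
      exact hY.self_of_nhds.of_le (WithTop.coe_le_coe.2 le_top)
    exact (h1.comp 0 hTs).clm_apply
      (L.toContinuousLinearMap.contDiff.contDiffAt.comp 0 h2)
  have hb : ∀ᶠ σ in 𝓝 0, fderiv ℝ H σ (b σ) = Y (H σ) := by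
    filter_upwards [hTu, htan] with σ h1 ⟨u, hu⟩
    have h2 : b σ = u := by
      have h3 : L.toContinuousLinearMap (Y (H σ)) = T σ u := by rw [← hu]; rfl
      simp only [b, h3]
      exact congrArg (fun A : (Fin n → ℝ) →L[ℝ] (Fin n → ℝ) => A u) (Ring.inverse_mul_cancel _ h1)
    rw [h2]; exact hu
  intro c hc0 hc
  -- `H` sends the integral curve of the lift to an integral curve of `Y`. By uniqueness this is
  -- `c`, which therefore stays in the plaque and so in the orbit of `x₀`.
  obtain ⟨σ, hσ0, hσ⟩ : ∃ σ : ℝ → Fin n → ℝ, σ 0 = 0 ∧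
      ∀ᶠ s in 𝓝 0, HasDerivAt σ (b (σ s)) s := by
    obtain ⟨α, hα⟩ := hbs.exists_eventually_eq_hasDerivAt 0
    have h1 : Tendsto (fun s : ℝ => ((0 : Fin n → ℝ), s)) (𝓝 0) (𝓝 0 ×ˢ 𝓝 0) := by
      rw [← nhds_prod_eq]
      exact (Continuous.prodMk_right (0 : Fin n → ℝ)).tendsto 0
    have h2 := h1.eventually hα
    exact ⟨α 0, h2.self_of_nhds.1, h2.mono fun s hs => hs.2⟩
  have hσt : Tendsto σ (𝓝 0) (𝓝 0) := by
    simpa [ContinuousAt, hσ0] using hσ.self_of_nhds.continuousAt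
  have hHσ : ∀ᶠ s in 𝓝 0, HasDerivAt (fun s => H (σ s)) (Y (H (σ s))) s := by
    filter_upwards [hσ, hσt.eventually hb, hσt.eventually hH.smooth] with s h1 h2 h3
    rw [← h2]
    exact (h3.differentiableAt (by simp)).hasFDerivAt.comp_hasDerivAt s h1
  have heq : c =ᶠ[𝓝 0] fun s => H (σ s) := by
    refine eventuallyEq_of_hasDerivAt ?_ hc hHσ (by rw [hc0, hσ0, hH.map_zero])
    rw [hc0]
    exact hY.self_of_nhds.of_le (WithTop.coe_le_coe.2 le_top)
  filter_upwards [heq, hσt.eventually hH.equiv] with s h1 h2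
  rw [h1, h2.mem_iff]

end Orbits

/-! ### From infinitesimal to local equivalence. -/

section Integration

variable {𝕂 : Type*} [RCLike 𝕂] {E F : Type*} [NormedAddCommGroup E] [NormedSpace 𝕂 E]
  [NormedSpace ℝ E] [IsScalarTower ℝ 𝕂 E] [NormedAddCommGroup F] [NormedSpace 𝕂 F]
  [NormedSpace ℝ F] [IsScalarTower ℝ 𝕂 F]

/-- The vector field `(1, η, y ↦ B y)` on `𝕂 × E × G`, linear in the last variable. -/
def linearExtension {G : Type*} (η : 𝕂 × E → E) (B : 𝕂 × E → G → G) (w : 𝕂 × E × G) :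
    𝕂 × E × G :=
  (1, η (w.1, w.2.1), B (w.1, w.2.1) w.2.2)

omit [NormedSpace 𝕂 E] [IsScalarTower ℝ 𝕂 E] in
theorem hasDerivAt_linearExtension {G : Type*} [NormedAddCommGroup G] [NormedSpace ℝ G]
    {η : 𝕂 × E → E} {B : 𝕂 × E → G → G}
    {c : ℝ → 𝕂 × E × G} {s : ℝ} (h : HasDerivAt c (linearExtension η B (c s)) s) :
    HasDerivAt (fun s => (c s).1) 1 s ∧
      HasDerivAt (fun s => (c s).2.1) (η ((c s).1, (c s).2.1)) s ∧
      HasDerivAt (fun s => (c s).2.2) (B ((c s).1, (c s).2.1) (c s).2.2) s := by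
  exact ⟨h.fst, h.snd.fst, h.snd.snd⟩

omit [NormedSpace ℝ E] [IsScalarTower ℝ 𝕂 E] in
theorem contDiffAt_linearExtension {n : WithTop ℕ∞} {G : Type*} [NormedAddCommGroup G]
    [NormedSpace 𝕂 G] {η : 𝕂 × E → E} {B : 𝕂 × E → G →L[𝕂] G} {w : 𝕂 × E × G}
    (hη : ContDiffAt 𝕂 n η (w.1, w.2.1)) (hB : ContDiffAt 𝕂 n B (w.1, w.2.1)) :
    ContDiffAt 𝕂 n (linearExtension η fun z => B z) w := by
  have h : ContDiffAt 𝕂 n (fun w : 𝕂 × E × G => (w.1, w.2.1)) w :=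
    contDiffAt_fst.prodMk contDiffAt_snd.fst
  exact contDiffAt_const.prodMk ((hη.comp w h).prodMk ((hB.comp w h).clm_apply contDiffAt_snd.snd))

/-- Integration of the infinitesimal equivalence `d𝓗 (1, η) = B 𝓗` along the family `𝓗`. -/
theorem exists_equivalence_of_infinitesimal [CompleteSpace E] [CompleteSpace F] (r : Regularity)
    {t₀ : 𝕂} {𝓗 : 𝕂 × E → F} {η : 𝕂 × E → E} {B : 𝕂 × E → F →L[𝕂] F} {V : Set E}
    (h𝓗 : ∀ᶠ z in 𝓝 (t₀, 0), ContDiffAt 𝕂 r.order 𝓗 z)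
    (hη : ∀ᶠ z in 𝓝 (t₀, 0), ContDiffAt 𝕂 r.order η z)
    (hη0 : ∀ᶠ t in 𝓝 t₀, η (t, 0) = 0)
    (hB : ∀ᶠ z in 𝓝 (t₀, 0), ContDiffAt 𝕂 r.order B z)
    (heq : ∀ᶠ z in 𝓝 (t₀, 0), fderiv 𝕂 𝓗 z (1, η z) = B z (𝓗 z))
    (hV : ∀ᶠ z in 𝓝 (t₀, 0), Invariant (fun z => (1, η z)) {z : 𝕂 × E | z.2 ∈ V} z) :
    ∀ᶠ τ : ℝ in 𝓝 0, ∃ (φ : E → E) (M : E → F →L[𝕂] F), φ 0 = 0 ∧ SmoothNear 𝕂 r φ ∧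
      (∃ φ' : E ≃L[𝕂] E, HasFDerivAt φ (φ' : E →L[𝕂] E) 0) ∧ SmoothNear 𝕂 r M ∧ IsUnit (M 0) ∧
      (∀ᶠ x in 𝓝 0, 𝓗 (t₀ + τ, φ x) = M x (𝓗 (t₀, x))) ∧ ∀ᶠ x in 𝓝 0, (φ x ∈ V ↔ x ∈ V) := by
  -- A single autonomous flow from `(t₀, x, 1)` yields everything: its components are the time, the
  -- coordinate change `φ`, and the fundamental solution `M` of `y' = B y` along the curve.
  let BB : 𝕂 × E → (F →L[𝕂] F) → F →L[𝕂] F := fun z A => (B z).comp A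
  let f : 𝕂 × E × (F →L[𝕂] F) → 𝕂 × E × (F →L[𝕂] F) := linearExtension η BB
  let w₀ : 𝕂 × E × (F →L[𝕂] F) := (t₀, 0, 1)
  have hproj : Tendsto (fun w : 𝕂 × E × (F →L[𝕂] F) => (w.1, w.2.1)) (𝓝 w₀) (𝓝 (t₀, 0)) :=
    (by fun_prop : Continuous fun w : 𝕂 × E × (F →L[𝕂] F) => (w.1, w.2.1)).tendsto w₀
  have hprojs (w : 𝕂 × E × (F →L[𝕂] F)) : ContDiffAt 𝕂 r.order
      (fun w : 𝕂 × E × (F →L[𝕂] F) => (w.1, w.2.1)) w :=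
    contDiffAt_fst.prodMk contDiffAt_snd.fst
  have hf : ∀ᶠ w in 𝓝 w₀, ContDiffAt 𝕂 r.order f w := by
    filter_upwards [hproj.eventually hη, hproj.eventually hB] with w h1 h2
    exact contDiffAt_const.prodMk ((h1.comp w (hprojs w)).prodMk
      ((h2.comp w (hprojs w)).clm_comp contDiffAt_snd.snd))
  obtain ⟨Φ, hΦs, hΦ0, hΦd⟩ := exists_smooth_flow r hf
  let ι : ℝ × E → 𝕂 × 𝕂 × E × (F →L[𝕂] F) := fun z => ((z.1 : 𝕂), (t₀, z.2, 1))
  have hιc : Continuous ι :=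
    (RCLike.continuous_ofReal.comp continuous_fst).prodMk (by fun_prop)
  have hι0 : ι (0, 0) = (0, w₀) := by simp [ι, w₀]
  have hι : Tendsto ι (𝓝 (0, 0)) (𝓝 (0, w₀)) := hι0 ▸ hιc.tendsto _
  let P : ℝ × E → 𝕂 × E × (F →L[𝕂] F) := fun z => Φ (ι z)
  have hP0 : ∀ᶠ x in 𝓝 (0 : E), P (0, x) = (t₀, x, 1) := by
    have h1 : Tendsto (fun x : E => (t₀, x, (1 : F →L[𝕂] F))) (𝓝 0) (𝓝 w₀) :=
      (by fun_prop : Continuous _).tendsto _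
    filter_upwards [h1.eventually hΦ0] with x hx
    simpa [P, ι] using hx
  have hP00 : P (0, 0) = w₀ := hP0.self_of_nhds
  have hPt : Tendsto P (𝓝 (0, 0)) (𝓝 w₀) := by
    have h1 : Tendsto Φ (𝓝 (0, w₀)) (𝓝 (Φ (0, w₀))) := hΦs.self_of_nhds.continuousAt
    have h2 : Φ (0, w₀) = w₀ := hΦ0.self_of_nhds
    exact (h2 ▸ h1).comp hι
  have hPs : ∀ᶠ z in 𝓝 ((0 : ℝ), (0 : E)), ContDiffAt 𝕂 r.order Φ (ι z) := hι.eventually hΦs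
  have hPd : ∀ᶠ z in 𝓝 ((0 : ℝ), (0 : E)), HasDerivAt (fun s => P (s, z.2)) (f (P z)) z.1 := by
    have h1 : Tendsto (fun z : ℝ × E => (z.1, (t₀, z.2, (1 : F →L[𝕂] F)))) (𝓝 (0, 0))
        (𝓝 (0, w₀)) := (by fun_prop : Continuous _).tendsto _
    exact h1.eventually hΦd
  have hgood : ∀ᶠ z in 𝓝 (t₀, (0 : E)), ContDiffAt 𝕂 r.order 𝓗 z ∧ ContDiffAt 𝕂 r.order η z ∧
      ContDiffAt 𝕂 r.order B z ∧ fderiv 𝕂 𝓗 z (1, η z) = B z (𝓗 z) ∧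
      Invariant (fun z => (1, η z)) {z : 𝕂 × E | z.2 ∈ V} z := by
    filter_upwards [h𝓗, hη, hB, heq, hV] with z h1 h2 h3 h4 h5 using ⟨h1, h2, h3, h4, h5⟩
  have hline : ∀ᶠ z in 𝓝 ((0 : ℝ), (0 : E)), η (t₀ + z.1, 0) = 0 := by
    have h1 : Tendsto (fun z : ℝ × E => t₀ + (z.1 : 𝕂)) (𝓝 (0, 0)) (𝓝 t₀) :=
      (continuous_const.add (RCLike.continuous_ofReal.comp continuous_fst)).tendsto' _ _ (by simp)
    exact h1.eventually hη0
  obtain ⟨δ, hδ, hb⟩ := Metric.eventually_nhds_iff_ball.1 (hPs.and (hPd.and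
    (((hproj.comp hPt).eventually hgood).and (hline.and
      ((continuous_snd.tendsto ((0 : ℝ), (0 : E))).eventually hP0)))))
  have hmem (s : ℝ) (hs : s ∈ Metric.ball (0 : ℝ) δ) (x : E) (hx : x ∈ Metric.ball (0 : E) δ) :
      (s, x) ∈ Metric.ball ((0 : ℝ), (0 : E)) δ := by
    rw [Metric.mem_ball, Prod.dist_eq, max_lt_iff]
    exact ⟨hs, hx⟩
  have hIo : IsOpen (Metric.ball (0 : ℝ) δ) := Metric.isOpen_ball
  have hIc : IsPreconnected (Metric.ball (0 : ℝ) δ) := (convex_ball (0 : ℝ) δ).isPreconnected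
  have hI0 : (0 : ℝ) ∈ Metric.ball (0 : ℝ) δ := Metric.mem_ball_self hδ
  have hE0 : (0 : E) ∈ Metric.ball (0 : E) δ := Metric.mem_ball_self hδ
  have hd (s) (hs : s ∈ Metric.ball (0 : ℝ) δ) (x) (hx : x ∈ Metric.ball (0 : E) δ) :=
    hasDerivAt_linearExtension (hb _ (hmem s hs x hx)).2.1
  have hgd (s) (hs : s ∈ Metric.ball (0 : ℝ) δ) (x) (hx : x ∈ Metric.ball (0 : E) δ) :=
    (hb _ (hmem s hs x hx)).2.2.1
  have hinit (x) (hx : x ∈ Metric.ball (0 : E) δ) : P (0, x) = (t₀, x, 1) :=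
    (hb _ (hmem 0 hI0 x hx)).2.2.2.2
  have hcast (s : ℝ) : HasDerivAt (fun s : ℝ => t₀ + (s : 𝕂)) 1 s := by
    simpa using (RCLike.ofRealCLM (K := 𝕂)).hasDerivAt.const_add t₀
  have htime (s) (hs : s ∈ Metric.ball (0 : ℝ) δ) (x) (hx : x ∈ Metric.ball (0 : E) δ) :
      (P (s, x)).1 = t₀ + s := by
    refine eqOn_of_hasDerivAt (v := fun _ => (1 : 𝕂)) hIo hIc
      (γ := fun s => (P (s, x)).1) (γ' := fun s : ℝ => t₀ + (s : 𝕂))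
      (fun _ _ => contDiffAt_const) (fun s hs => (hd s hs x hx).1) (fun s _ => hcast s) hI0 ?_ hs
    simp [hinit x hx]
  have hzero (s) (hs : s ∈ Metric.ball (0 : ℝ) δ) : (P (s, 0)).2.1 = 0 := by
    have h1 := eqOn_of_hasDerivAt (v := fun z : 𝕂 × E => ((1 : 𝕂), η z)) hIo hIc
      (γ := fun s => ((P (s, 0)).1, (P (s, 0)).2.1)) (γ' := fun s : ℝ => (t₀ + (s : 𝕂), (0 : E)))
      (fun s hs => ?_) (fun s hs => (hd s hs 0 hE0).1.prodMk (hd s hs 0 hE0).2.1) (fun s hs => ?_) hI0 ?_ hs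
    · exact congrArg Prod.snd h1
    · exact contDiffAt_const.prodMk
        ((hgd s hs 0 hE0).2.1.restrict_scalars ℝ |>.of_le r.one_le_order)
    · rw [(hb _ (hmem s hs 0 hE0)).2.2.2.1]
      exact (hcast s).prodMk (hasDerivAt_const _ _)
    · simp [hP00, w₀]
  -- By the infinitesimal equation, `𝓗` along the curve solves `y' = B y`; so does the fundamental
  -- solution applied to `𝓗 (t₀, x)`. They agree at time `0`.
  have hconj (s) (hs : s ∈ Metric.ball (0 : ℝ) δ) (x) (hx : x ∈ Metric.ball (0 : E) δ) :
      𝓗 (t₀ + s, (P (s, x)).2.1) = (P (s, x)).2.2 (𝓗 (t₀, x)) := by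
    have h1 := eqOn_of_hasDerivAt (v := linearExtension η fun z => B z) hIo hIc
      (γ := fun s => ((P (s, x)).1, (P (s, x)).2.1, 𝓗 ((P (s, x)).1, (P (s, x)).2.1)))
      (γ' := fun s => ((P (s, x)).1, (P (s, x)).2.1, (P (s, x)).2.2 (𝓗 (t₀, x))))
      (fun s hs => ?_) (fun s hs => ?_) (fun s hs => ?_) hI0 ?_ hs
    · have := congrArg (fun w => w.2.2) h1
      simpa [htime s hs x hx] using this
    · obtain ⟨-, h2, h3, -, -⟩ := hgd s hs x hx
      have h4 : ContDiffAt 𝕂 r.order (linearExtension η fun z => B z)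
          ((P (s, x)).1, (P (s, x)).2.1, 𝓗 ((P (s, x)).1, (P (s, x)).2.1)) :=
        contDiffAt_linearExtension h2 h3
      exact (h4.restrict_scalars ℝ).of_le r.one_le_order
    · obtain ⟨h2, -, -, h3, -⟩ := hgd s hs x hx
      obtain ⟨h4, h5, -⟩ := hd s hs x hx
      refine h4.prodMk (h5.prodMk ?_)
      have h6 := ((h2.differentiableAt r.order_ne_zero).hasFDerivAt.restrictScalars
        ℝ).comp_hasDerivAt s (h4.prodMk h5)
      exact h6.congr_deriv h3
    · obtain ⟨h4, h5, h6⟩ := hd s hs x hx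
      refine h4.prodMk (h5.prodMk ?_)
      have h7 : HasFDerivAt (fun A : F →L[𝕂] F => A (𝓗 (t₀, x)))
          ((ContinuousLinearMap.apply 𝕂 F (𝓗 (t₀, x))).restrictScalars ℝ) (P (s, x)).2.2 :=
        (ContinuousLinearMap.apply 𝕂 F (𝓗 (t₀, x))).hasFDerivAt.restrictScalars ℝ
      exact h7.comp_hasDerivAt s h6
    · simp [hinit x hx]
  have hpres (s) (hs : s ∈ Metric.ball (0 : ℝ) δ) (x) (hx : x ∈ Metric.ball (0 : E) δ) :
      (P (s, x)).2.1 ∈ V ↔ x ∈ V := by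
    have h1 := Invariant.mem_iff hIo hIc (X := fun z : 𝕂 × E => ((1 : 𝕂), η z))
      (V := {z : 𝕂 × E | z.2 ∈ V}) (γ := fun s => ((P (s, x)).1, (P (s, x)).2.1))
      (fun s hs => (hd s hs x hx).1.prodMk (hd s hs x hx).2.1) (fun s hs => (hgd s hs x hx).2.2.2.2) hs hI0
    simpa [hinit x hx] using h1
  let j : E →L[𝕂] 𝕂 × 𝕂 × E × (F →L[𝕂] F) :=
    (ContinuousLinearMap.inr 𝕂 𝕂 _).comp ((ContinuousLinearMap.inr 𝕂 𝕂 _).comp (.inl 𝕂 E _))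
  let pr : 𝕂 × E × (F →L[𝕂] F) →L[𝕂] E := (ContinuousLinearMap.fst 𝕂 E _).comp (.snd 𝕂 𝕂 _)
  have hιx (z : ℝ × E) : HasFDerivAt (fun x => ι (z.1, x)) j z.2 :=
    ((hasFDerivAt_const (z.1 : 𝕂) z.2).prodMk ((hasFDerivAt_const t₀ z.2).prodMk
      ((hasFDerivAt_id z.2).prodMk (hasFDerivAt_const (1 : F →L[𝕂] F) z.2)))).congr_fderiv
      (by ext <;> simp [j])
  have hφd (z : ℝ × E) (hz : z ∈ Metric.ball ((0 : ℝ), (0 : E)) δ) :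
      HasFDerivAt (fun x => (P (z.1, x)).2.1) (pr.comp ((fderiv 𝕂 Φ (ι z)).comp j)) z.2 :=
    pr.hasFDerivAt.comp z.2 (((hb z hz).1.differentiableAt
      r.order_ne_zero).hasFDerivAt.comp z.2 (hιx z))
  have hz0 : ((0 : ℝ), (0 : E)) ∈ Metric.ball ((0 : ℝ), (0 : E)) δ := Metric.mem_ball_self hδ
  have hinv : ∀ᶠ τ : ℝ in 𝓝 0, pr.comp ((fderiv 𝕂 Φ (ι (τ, 0))).comp j) ∈
      range ((↑) : (E ≃L[𝕂] E) → E →L[𝕂] E) := by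
    have h1 : ContinuousAt (fderiv 𝕂 Φ) (ι (0, 0)) :=
      ((hb _ hz0).1.fderiv_right r.order_add_one).continuousAt
    have h2 : ContinuousAt (fun τ : ℝ => ι (τ, 0)) 0 :=
      (hιc.comp (Continuous.prodMk_left 0)).continuousAt
    have h3 : ContinuousAt (fun τ : ℝ => pr.comp ((fderiv 𝕂 Φ (ι (τ, 0))).comp j)) 0 :=
      continuousAt_const.clm_comp ((ContinuousAt.comp (g := fderiv 𝕂 Φ)
        (f := fun τ : ℝ => ι (τ, 0)) (x := (0 : ℝ)) h1 h2).clm_comp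
        continuousAt_const)
    refine h3.eventually_mem ?_
    have h4 : pr.comp ((fderiv 𝕂 Φ (ι (0, 0))).comp j) = ContinuousLinearEquiv.refl 𝕂 E := by
      refine (hφd _ hz0).unique ((hasFDerivAt_id (0 : E)).congr_of_eventuallyEq ?_)
      filter_upwards [hP0] with x hx
      simp [hx]
    rw [h4]
    exact ContinuousLinearEquiv.nhds _
  have hunit : ∀ᶠ τ : ℝ in 𝓝 0, IsUnit (P (τ, 0)).2.2 := by
    have h1 : Tendsto (fun τ : ℝ => (P (τ, 0)).2.2) (𝓝 0) (𝓝 1) :=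
      ((continuous_snd.comp continuous_snd).tendsto w₀).comp
        (hPt.comp ((Continuous.prodMk_left (0 : E)).tendsto (0 : ℝ)))
    exact h1.eventually (Units.isOpen.mem_nhds isUnit_one)
  filter_upwards [hinv, hunit, hIo.mem_nhds hI0] with τ ⟨A, hA⟩ hu hτ
  have hxs : ∀ᶠ x in 𝓝 (0 : E), ContDiffAt 𝕂 r.order (fun x => P (τ, x)) x := by
    filter_upwards [Metric.ball_mem_nhds _ hδ] with x hx
    have h1 : ContDiffAt 𝕂 r.order (fun x : E => ((τ : 𝕂), (t₀, x, (1 : F →L[𝕂] F)))) x :=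
      contDiffAt_const.prodMk (contDiffAt_const.prodMk (contDiffAt_id.prodMk contDiffAt_const))
    exact (hb _ (hmem τ hτ x hx)).1.comp x h1
  refine ⟨fun x => (P (τ, x)).2.1, fun x => (P (τ, x)).2.2, hzero τ hτ, ?_, ⟨A, ?_⟩, ?_, hu, ?_, ?_⟩
  · exact hxs.mono fun x hx => contDiffAt_snd.fst.comp x hx
  · rw [hA]; exact hφd (τ, 0) (hmem τ hτ 0 hE0)
  · exact hxs.mono fun x hx => contDiffAt_snd.snd.comp x hx
  · filter_upwards [Metric.ball_mem_nhds _ hδ] with x hx using hconj τ hτ x hx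
  · filter_upwards [Metric.ball_mem_nhds _ hδ] with x hx using hpres τ hτ x hx

end Integration

/-! ### Equivalence by coordinate changes and invertible matrices. -/

section Contact

variable {𝕂 : Type*} [RCLike 𝕂] {E F : Type*} [NormedAddCommGroup E] [NormedSpace 𝕂 E]
  [NormedAddCommGroup F] [NormedSpace 𝕂 F]

/-- Equivalence of `f` and `g` by a coordinate change preserving `V` and an invertible matrix. -/
def ContactEquivalent (𝕂 : Type*) [RCLike 𝕂] (r : Regularity) {E F : Type*} [NormedAddCommGroup E]
    [NormedSpace 𝕂 E] [NormedAddCommGroup F] [NormedSpace 𝕂 F] (V : Set E) (f g : E → F) : Prop :=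
  ∃ (φ : E → E) (M : E → F →L[𝕂] F), φ 0 = 0 ∧ SmoothNear 𝕂 r φ ∧
    (∃ φ' : E ≃L[𝕂] E, HasFDerivAt φ (φ' : E →L[𝕂] E) 0) ∧ SmoothNear 𝕂 r M ∧ IsUnit (M 0) ∧
    (∀ᶠ x in 𝓝 0, g (φ x) = M x (f x)) ∧ ∀ᶠ x in 𝓝 0, (φ x ∈ V ↔ x ∈ V)

theorem ringInverse_apply_apply {A : F →L[𝕂] F} (hA : IsUnit A) (v : F) :
    Ring.inverse A (A v) = v :=
  congrArg (fun B : F →L[𝕂] F => B v) (Ring.inverse_mul_cancel A hA)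

theorem apply_ringInverse_apply {A : F →L[𝕂] F} (hA : IsUnit A) (v : F) :
    A (Ring.inverse A v) = v :=
  congrArg (fun B : F →L[𝕂] F => B v) (Ring.mul_inverse_cancel A hA)

theorem SmoothNear.tendsto {r : Regularity} {f : E → F} (h : SmoothNear 𝕂 r f) :
    Tendsto f (𝓝 0) (𝓝 (f 0)) :=
  h.self_of_nhds.continuousAt

theorem SmoothNear.eventually_isUnit [CompleteSpace F] {r : Regularity} {M : E → F →L[𝕂] F}
    (hM : SmoothNear 𝕂 r M) (h : IsUnit (M 0)) : ∀ᶠ x in 𝓝 0, IsUnit (M x) :=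
  hM.tendsto.eventually (Units.isOpen.mem_nhds h)

theorem SmoothNear.ringInverse [CompleteSpace F] {r : Regularity} {M : E → F →L[𝕂] F}
    (hM : SmoothNear 𝕂 r M) (h : IsUnit (M 0)) : SmoothNear 𝕂 r fun x => Ring.inverse (M x) := by
  filter_upwards [hM, hM.eventually_isUnit h] with x h1 ⟨u, hu⟩
  have h2 : ContDiffAt 𝕂 r.order Ring.inverse (M x) := by
    rw [← hu]; exact contDiffAt_ringInverse 𝕂 u
  exact h2.comp x h1

namespace ContactEquivalent

variable {r : Regularity} {V : Set E} {f g h : E → F}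

theorem trans (h1 : ContactEquivalent 𝕂 r V f g) (h2 : ContactEquivalent 𝕂 r V g h) :
    ContactEquivalent 𝕂 r V f h := by
  obtain ⟨φ, M, hφ0, hφ, ⟨A, hA⟩, hM, hMu, hfg, hφV⟩ := h1
  obtain ⟨ψ, N, hψ0, hψ, ⟨B, hB⟩, hN, hNu, hgh, hψV⟩ := h2
  have ht : Tendsto φ (𝓝 0) (𝓝 0) := by simpa [hφ0] using hφ.tendsto
  refine ⟨ψ ∘ φ, fun x => N (φ x) * M x, by simp [hφ0, hψ0], ?_, ⟨A.trans B, ?_⟩, ?_, ?_, ?_, ?_⟩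
  · filter_upwards [hφ, ht.eventually hψ] with x h1 h2 using h2.comp x h1
  · exact HasFDerivAt.comp (g := ψ) 0 (by rwa [hφ0]) hA
  · filter_upwards [hφ, hM, ht.eventually hN] with x h1 h2 h3
    exact (h3.comp x h1).clm_comp h2
  · simpa only [hφ0] using hNu.mul hMu
  · filter_upwards [hfg, ht.eventually hgh] with x h1 h2
    rw [Function.comp_apply, h2, h1]
    rfl
  · filter_upwards [hφV, ht.eventually hψV] with x h1 h2 using h2.trans h1

theorem symm [CompleteSpace E] [CompleteSpace F] (h1 : ContactEquivalent 𝕂 r V f g) :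
    ContactEquivalent 𝕂 r V g f := by
  obtain ⟨φ, M, hφ0, hφ, ⟨A, hA⟩, hM, hMu, hfg, hφV⟩ := h1
  obtain ⟨χ, hχ0, hχ, hχφ, hφχ⟩ := exists_smooth_local_inverse r hφ A hA
  rw [hφ0] at hχ0 hχ hφχ
  have ht : Tendsto χ (𝓝 0) (𝓝 0) := by simpa [hχ0] using SmoothNear.tendsto hχ
  refine ⟨χ, fun x => Ring.inverse (M (χ x)), hχ0, hχ, ⟨A.symm, ?_⟩, ?_, ?_, ?_, ?_⟩
  · exact HasFDerivAt.of_local_left_inverse hχ.self_of_nhds.continuousAt (by rwa [hχ0]) hφχ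
  · filter_upwards [hχ, ht.eventually (hM.ringInverse hMu)] with x h1 h2 using h2.comp x h1
  · simpa only [hχ0] using hMu.ringInverse
  · filter_upwards [hφχ, ht.eventually hfg, ht.eventually (hM.eventually_isUnit hMu)]
      with x h1 h2 h3
    have h4 : M (χ x) (f (χ x)) = g x := by rw [← h2, h1]
    rw [← h4, ringInverse_apply_apply h3]
  · filter_upwards [hφχ, ht.eventually hφV] with x h1 h2
    rw [← h2, h1]

/-- Members of a family of maps parametrised by an interval that are locally equivalent are
equivalent. -/
theorem of_locally [CompleteSpace E] [CompleteSpace F] {H : ℝ → E → F} {a b : ℝ} (hab : a ≤ b)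
    (hH : ∀ t ∈ Icc a b, ∀ᶠ τ in 𝓝 0, ContactEquivalent 𝕂 r V (H t) (H (t + τ))) :
    ContactEquivalent 𝕂 r V (H a) (H b) := by
  -- An equivalence relation with relatively open classes on a connected interval has only one
  -- class.
  refine isPreconnected_Icc.induction₂ (fun s t => ContactEquivalent 𝕂 r V (H s) (H t))
    (fun t ht => ?_) (fun _ _ _ _ _ _ h1 h2 => h1.trans h2) (fun _ _ _ _ h => h.symm)
    (left_mem_Icc.2 hab) (right_mem_Icc.2 hab)
  have h1 : Tendsto (fun u : ℝ => u - t) (𝓝 t) (𝓝 0) := by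
    simpa using (continuous_sub_right t).tendsto t
  refine nhdsWithin_le_nhds ?_
  filter_upwards [h1.eventually (hH t ht)] with u hu
  simpa using hu

end ContactEquivalent

theorem isDiffeoGerm_of_hasFDerivAt [CompleteSpace E] {r : Regularity} {ψ : E → E} (h0 : ψ 0 = 0)
    (hs : SmoothNear 𝕂 r ψ) (A : E ≃L[𝕂] E) (hA : HasFDerivAt ψ (A : E →L[𝕂] E) 0) :
    IsDiffeoGerm 𝕂 r ψ := by
  obtain ⟨χ, hχ0, hχ, hχψ, hψχ⟩ := exists_smooth_local_inverse r hs A hA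
  rw [h0] at hχ0 hχ hψχ
  exact ⟨h0, hs, χ, hχ0, hχ, hχψ, hψχ⟩

/-- The required fibred diffeomorphism is `Ψ(x, y) = (φ x, M x y)`; linearity in `y` preserves the
zero section. -/
theorem ContactEquivalent.equivalent {r : Regularity} {p q : ℕ} {V : Set (Fin p → 𝕂)}
    {f g : Tuple 𝕂 r p q} {H G : (Fin p → 𝕂) → (Fin q → 𝕂)} (hH : Represents H f)
    (hG : Represents G g) (h : ContactEquivalent 𝕂 r V H G) : Equivalent V f g := by
  obtain ⟨φ, M, hφ0, hφ, ⟨A, hA⟩, hM, hMu, hfg, hφV⟩ := h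
  obtain ⟨χ, hχ0, hχ, hχφ, hφχ⟩ := exists_smooth_local_inverse r hφ A hA
  rw [hφ0] at hχ0 hχ hφχ
  have ht : Tendsto χ (𝓝 0) (𝓝 0) := by simpa [hχ0] using SmoothNear.tendsto hχ
  have hfst : Tendsto (Prod.fst : (Fin p → 𝕂) × (Fin q → 𝕂) → _) (𝓝 0) (𝓝 0) :=
    continuous_fst.tendsto 0
  have hMi := hM.ringInverse hMu
  have hMu' := hM.eventually_isUnit hMu
  refine ⟨H, G, hH, hG, fun z => (φ z.1, M z.1 z.2), φ, ⟨by simp [hφ0], ?_,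
    fun z => (χ z.1, Ring.inverse (M (χ z.1)) z.2), by simp [hχ0], ?_, ?_, ?_⟩,
    isDiffeoGerm_of_hasFDerivAt hφ0 hφ A hA, .of_forall fun _ => rfl, ?_, ?_, ?_⟩
  · filter_upwards [hfst.eventually hφ, hfst.eventually hM] with z h1 h2
    exact (h1.comp z contDiffAt_fst).prodMk ((h2.comp z contDiffAt_fst).clm_apply contDiffAt_snd)
  · filter_upwards [hfst.eventually hχ, hfst.eventually (ht.eventually hMi)] with z h1 h2
    have h3 : ContDiffAt 𝕂 r.order
        (fun z : (Fin p → 𝕂) × (Fin q → 𝕂) => Ring.inverse (M (χ z.1))) z :=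
      ContDiffAt.comp (g := fun x => Ring.inverse (M x)) z h2 (h1.comp z contDiffAt_fst)
    exact (h1.comp z contDiffAt_fst).prodMk (h3.clm_apply contDiffAt_snd)
  · filter_upwards [hfst.eventually hχφ, hfst.eventually hMu'] with z h1 h2
    simp only [h1, ringInverse_apply_apply h2]
  · filter_upwards [hfst.eventually hφχ, hfst.eventually (ht.eventually hMu')] with z h1 h2
    simp only [h1, apply_ringInverse_apply h2]
  · filter_upwards [hfst.eventually hMu'] with z h1
    refine ⟨fun h => by rw [h, map_zero], fun h => ?_⟩
    rw [← ringInverse_apply_apply h1 z.2, h, map_zero]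
  · filter_upwards [hfst.eventually hMu', hfst.eventually hfg] with z h1 h2
    rw [h2]
    refine ⟨fun h => by rw [h], fun h => ?_⟩
    rw [← ringInverse_apply_apply h1 z.2, h, ringInverse_apply_apply h1]
  · exact hφV.mono fun x hx => hx.symm

end Contact

/-! ### Vector fields preserving `V`: suspension and order of vanishing. -/

section Fields

theorem Invariant.congr {E : Type*} [NormedAddCommGroup E] [NormedSpace ℝ E] {X Y : E → E}
    {V : Set E} {x : E} (h : Invariant X V x) (hXY : X =ᶠ[𝓝 x] Y) : Invariant Y V x := by
  intro c hc0 hc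
  have ht : Tendsto c (𝓝 0) (𝓝 x) := hc0 ▸ hc.self_of_nhds.continuousAt
  refine h c hc0 ?_
  filter_upwards [hc, ht.eventually hXY] with s h1 h2
  rwa [h2]

variable {𝕂 : Type*} [RCLike 𝕂]

theorem invariant_prod {E : Type*} [NormedAddCommGroup E] [NormedSpace ℝ E] {X : E → E}
    {V : Set E} {z : 𝕂 × E} (h : Invariant X V z.2) :
    Invariant (fun z : 𝕂 × E => (0, X z.2)) {z | z.2 ∈ V} z := by
  intro c hc0 hc
  exact h (fun s => (c s).2) (by rw [hc0]) (hc.mono fun s hs => hs.snd)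

theorem invariant_time {E : Type*} [NormedAddCommGroup E] [NormedSpace ℝ E] {V : Set E}
    (z : 𝕂 × E) : Invariant (fun _ : 𝕂 × E => (1, 0)) {z | z.2 ∈ V} z := by
  intro c hc0 hc
  have h1 : (fun s => (c s).2) =ᶠ[𝓝 0] fun _ => z.2 :=
    eventuallyEq_of_hasDerivAt (v := fun _ : E => (0 : E)) contDiffAt_const
      (hc.mono fun s hs => hs.snd) (.of_forall fun s => hasDerivAt_const s z.2) (by rw [hc0])
  filter_upwards [h1] with s hs
  rw [hs]

/-- The suspension of a time-dependent combination of vector fields leaving `V` invariant leaves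
`V` invariant. -/
theorem invariant_suspension {E : Type*} [NormedAddCommGroup E] [NormedSpace 𝕂 E]
    [NormedSpace ℝ E] [IsScalarTower ℝ 𝕂 E] [FiniteDimensional ℝ E] {r : Regularity} {V : Set E}
    {ι : Type*} [Fintype ι] {X : ι → E → E} {a : ι → 𝕂 × E → 𝕂} {t₀ : 𝕂}
    (hX : ∀ i, SmoothNear 𝕂 r (X i))
    (hV : ∀ i, ∀ᶠ x in 𝓝 0, ∀ u : 𝕂, Invariant (fun x => u • X i x) V x)
    (ha : ∀ i, ∀ᶠ z in 𝓝 (t₀, 0), ContDiffAt 𝕂 r.order (a i) z) :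
    ∀ᶠ z in 𝓝 (t₀, 0),
      Invariant (fun z => (1, ∑ i, a i z • X i z.2)) {z : 𝕂 × E | z.2 ∈ V} z := by
  have hsnd : Tendsto (fun z : 𝕂 × E => z.2) (𝓝 (t₀, 0)) (𝓝 0) := continuous_snd.tendsto _
  have hX' := eventually_all.2 fun i => hsnd.eventually ((hX i).and (hV i))
  filter_upwards [hX'.eventually_nhds, (eventually_all.2 ha).eventually_nhds] with z h1 h2
  -- The orbit argument uses real spans. Admitting all multiples `u • X i` with `u : 𝕂` as
  -- generators covers complex coefficients; `none` is the time direction.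
  let Y : Option (ι × 𝕂) → 𝕂 × E → 𝕂 × E
    | none => fun _ => (1, 0)
    | some (i, u) => fun z => (0, u • X i z.2)
  refine invariant_of_mem_span (X := Y) ?_ ?_ ?_
  · filter_upwards [h1] with w hw
    rintro (_ | ⟨i, u⟩)
    · exact ⟨contDiffAt_const, invariant_time w⟩
    · refine ⟨?_, invariant_prod ((hw i).2 u)⟩
      have h3 : ContDiffAt 𝕂 r.order (fun z : 𝕂 × E => ((0 : 𝕂), u • X i z.2)) w :=
        contDiffAt_const.prodMk (((hw i).1.comp w contDiffAt_snd).const_smul u)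
      exact (h3.restrict_scalars ℝ).of_le r.infty_le_order
  · filter_upwards [h1, h2] with w hw hw'
    have h3 : ContDiffAt 𝕂 r.order (fun z : 𝕂 × E => ((1 : 𝕂), ∑ i, a i z • X i z.2)) w :=
      contDiffAt_const.prodMk (ContDiffAt.sum fun i _ =>
        (hw' i).smul ((hw i).1.comp w contDiffAt_snd))
    exact (h3.restrict_scalars ℝ).of_le r.infty_le_order
  · refine .of_forall fun w => ?_
    have h3 : ((1 : 𝕂), ∑ i, a i w • X i w.2) = Y none w + ∑ i, Y (some (i, a i w)) w := by
      ext <;> simp [Y, Prod.fst_sum, Prod.snd_sum]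
    rw [h3]
    exact add_mem (Submodule.subset_span ⟨none, rfl⟩)
      (sum_mem fun i _ => Submodule.subset_span ⟨some (i, a i w), rfl⟩)

theorem Represents.smoothNear {r : Regularity} {p q : ℕ} {F : (Fin p → 𝕂) → (Fin q → 𝕂)}
    {f : Tuple 𝕂 r p q} (h : Represents F f) : SmoothNear 𝕂 r F := by
  have h1 (i : Fin q) : ∀ᶠ x in 𝓝 0, ContDiffAt 𝕂 r.order (fun x => F x i) x := by
    obtain ⟨G, hG, hGe⟩ := (f i).2
    have h2 : (fun x => F x i) =ᶠ[𝓝 0] G := Germ.coe_eq.1 ((h i).symm.trans hGe)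
    filter_upwards [hG, h2.eventually_nhds] with x h3 h4
    exact h3.congr_of_eventuallyEq h4
  filter_upwards [eventually_all.2 h1] with x hx
  exact contDiffAt_pi.2 hx

theorem Represents.eventuallyEq {r : Regularity} {p q : ℕ} {F G : (Fin p → 𝕂) → (Fin q → 𝕂)}
    {f : Tuple 𝕂 r p q} (hF : Represents F f) (hG : Represents G f) : F =ᶠ[𝓝 0] G := by
  have h1 (i : Fin q) : (fun x => F x i) =ᶠ[𝓝 0] fun x => G x i :=
    Germ.coe_eq.1 ((hF i).symm.trans (hG i))
  filter_upwards [eventually_all.2 h1] with x hx using funext hx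

theorem exists_represents {r : Regularity} {p q : ℕ} (f : Tuple 𝕂 r p q) :
    ∃ F : (Fin p → 𝕂) → (Fin q → 𝕂), Represents F f := by
  choose G hG hGe using fun i => (f i).2
  exact ⟨fun x i => G i x, hGe⟩

/-- The curves `s ↦ Φ (s u) x` in real time are the integral curves of `u • X`, by uniqueness. For
complex `u` this uses the flow at complex times. -/
theorem invariant_of_mem_Theta {r : Regularity} {p : ℕ} {V : Set (Fin p → 𝕂)}
    {ξ : Tuple 𝕂 r p p} (hξ : ξ ∈ Theta r V) {X : (Fin p → 𝕂) → (Fin p → 𝕂)}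
    (hX : Represents X ξ) :
    ∀ᶠ x in 𝓝 0, ∀ u : 𝕂, Invariant (fun x => u • X x) V x := by
  obtain ⟨Φ, ⟨Y, hY, hΦ⟩, hΦV⟩ := hξ
  obtain ⟨δ, hδ, hb⟩ := Metric.eventually_nhds_iff_ball.1 (hΦ.and hΦV)
  filter_upwards [Metric.ball_mem_nhds 0 hδ, (hY.eventuallyEq hX).eventually_nhds,
    hY.smoothNear] with x hx hYX hYs u
  refine Invariant.congr (X := fun x => u • Y x) ?_ (hYX.mono fun y hy => by simp only [hy])
  intro c hc0 hc
  have hsu : ∀ᶠ s : ℝ in 𝓝 0, (s : 𝕂) * u ∈ Metric.ball (0 : 𝕂) δ :=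
    (Continuous.tendsto' (by fun_prop) (0 : ℝ) (0 : 𝕂) (by simp) :
      Tendsto (fun s : ℝ => (s : 𝕂) * u) (𝓝 0) (𝓝 0)).eventually (Metric.ball_mem_nhds _ hδ)
  have hmem (t : 𝕂) (ht : t ∈ Metric.ball (0 : 𝕂) δ) :
      (t, x) ∈ Metric.ball (0 : 𝕂 × (Fin p → 𝕂)) δ := by
    rw [Metric.mem_ball, Prod.dist_eq, max_lt_iff]
    exact ⟨ht, hx⟩
  have h0 : Φ 0 x = x := (hb _ (hmem 0 (Metric.mem_ball_self hδ))).1.1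
  have heq : c =ᶠ[𝓝 0] fun s : ℝ => Φ ((s : 𝕂) * u) x := by
    refine eventuallyEq_of_hasDerivAt (v := fun x => u • Y x) ?_ hc ?_ (by simp [hc0, h0])
    · rw [hc0]
      exact ((hYs.const_smul u).restrict_scalars ℝ).of_le r.one_le_order
    · filter_upwards [hsu] with s hs
      have h1 := (hb _ (hmem _ hs)).1.2
      have h2 : HasDerivAt (fun s : ℝ => (s : 𝕂) * u) u s := by
        simpa using (RCLike.ofRealCLM (K := 𝕂)).hasDerivAt.mul_const u
      exact h1.scomp s h2
  filter_upwards [heq, hsu] with s h1 h2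
  rw [h1]
  exact (hb _ (hmem _ h2)).2

/-- The field is the time derivative of its flow at time zero, so its spatial derivative at the
origin is a mixed second derivative. In the other order this differentiates the constant identity
`1`-jet, giving zero. -/
theorem fderiv_eq_zero_of_mem_ThetaOne {r : Regularity} {p : ℕ} {V : Set (Fin p → 𝕂)}
    {ξ : Tuple 𝕂 r p p} (hξ : ξ ∈ ThetaOne r V) {X : (Fin p → 𝕂) → (Fin p → 𝕂)}
    (hX : Represents X ξ) : X 0 = 0 ∧ fderiv 𝕂 X 0 = 0 := by
  obtain ⟨Φ, ⟨Y, hY, hΦ⟩, -, hΦ1⟩ := hξ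
  have hYX := hY.eventuallyEq hX
  suffices h : Y 0 = 0 ∧ fderiv 𝕂 Y 0 = 0 by
    rwa [hYX.self_of_nhds, hYX.fderiv_eq] at h
  have hYs := hY.smoothNear
  obtain ⟨Ψ, hΨs, hΨ0, hΨd⟩ := exists_smooth_flow r hYs
  have hΨ00 : Ψ (0, 0) = 0 := hΨ0.self_of_nhds
  have hιc : Continuous fun z : ℝ × (Fin p → 𝕂) => ((z.1 : 𝕂), z.2) :=
    (RCLike.continuous_ofReal.comp continuous_fst).prodMk continuous_snd
  have hι : Tendsto (fun z : ℝ × (Fin p → 𝕂) => ((z.1 : 𝕂), z.2)) (𝓝 (0, 0)) (𝓝 (0, 0)) :=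
    hιc.tendsto' _ _ (by simp)
  have hΨt : Tendsto Ψ (𝓝 (0, 0)) (𝓝 0) := by
    simpa [ContinuousAt, hΨ00] using hΨs.self_of_nhds.continuousAt
  obtain ⟨δ, hδ, hb⟩ := Metric.eventually_nhds_iff_ball.1 (hΨd.and
    ((hι.eventually (hΨs.and (hΨt.eventually hYs))).and ((hι.eventually hΦ).and
      ((continuous_snd.tendsto ((0 : ℝ), (0 : Fin p → 𝕂))).eventually hΨ0))))
  have hmem (s : ℝ) (hs : s ∈ Metric.ball (0 : ℝ) δ) (x : Fin p → 𝕂)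
      (hx : x ∈ Metric.ball (0 : Fin p → 𝕂) δ) :
      (s, x) ∈ Metric.ball ((0 : ℝ), (0 : Fin p → 𝕂)) δ := by
    rw [Metric.mem_ball, Prod.dist_eq, max_lt_iff]
    exact ⟨hs, hx⟩
  have hI0 : (0 : ℝ) ∈ Metric.ball (0 : ℝ) δ := Metric.mem_ball_self hδ
  -- The given flow `Φ` is not assumed jointly differentiable, so it is replaced by the regular flow
  -- `Ψ`, with which it agrees at real times.
  have hflow (s : ℝ) (hs : s ∈ Metric.ball (0 : ℝ) δ) (x : Fin p → 𝕂)
      (hx : x ∈ Metric.ball (0 : Fin p → 𝕂) δ) : Ψ ((s : 𝕂), x) = Φ s x := by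
    refine eqOn_of_hasDerivAt (v := Y) Metric.isOpen_ball (convex_ball (0 : ℝ) δ).isPreconnected
      (γ := fun s : ℝ => Ψ ((s : 𝕂), x)) (γ' := fun s : ℝ => Φ s x) (fun s hs => ?_)
      (fun s hs => (hb _ (hmem s hs x hx)).1) (fun s hs => ?_) hI0 ?_ hs
    · exact ((hb _ (hmem s hs x hx)).2.1.2.restrict_scalars ℝ).of_le r.one_le_order
    · have h1 := (hb _ (hmem s hs x hx)).2.2.1.2
      have h2 : HasDerivAt (fun s : ℝ => (s : 𝕂)) 1 s := by
        simpa using (RCLike.ofRealCLM (K := 𝕂)).hasDerivAt (x := s)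
      have h3 := h1.scomp s h2
      rwa [one_smul] at h3
    · have h1 := (hb _ (hmem 0 hI0 x hx)).2.2.2
      have h2 := (hb _ (hmem 0 hI0 x hx)).2.2.1.1
      simp only [RCLike.ofReal_zero] at h2 ⊢
      rw [h1, h2]
  have hΨs0 := hΨs.self_of_nhds
  have hpart (z : 𝕂 × (Fin p → 𝕂)) (hz : ContDiffAt 𝕂 r.order Ψ z) :
      HasFDerivAt Ψ (fderiv 𝕂 Ψ z) z := (hz.differentiableAt r.order_ne_zero).hasFDerivAt
  have hofReal : Tendsto (fun s : ℝ => (s : 𝕂)) (𝓝 0) (𝓝 0) :=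
    RCLike.continuous_ofReal.tendsto' _ _ (by simp)
  have hcurve : HasDerivAt (fun s : ℝ => ((s : 𝕂), (0 : Fin p → 𝕂))) (1, 0) 0 := by
    refine HasDerivAt.prodMk ?_ (hasDerivAt_const _ _)
    simpa using (RCLike.ofRealCLM (K := 𝕂)).hasDerivAt (x := (0 : ℝ))
  have htime (x : Fin p → 𝕂) (hx : x ∈ Metric.ball (0 : Fin p → 𝕂) δ) :
      fderiv 𝕂 Ψ (0, x) (1, 0) = Y x := by
    obtain ⟨h1, ⟨h2, -⟩, -, h3⟩ := hb _ (hmem 0 hI0 x hx)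
    simp only [RCLike.ofReal_zero] at h1 h2 h3
    have h4 : HasDerivAt (fun s : ℝ => ((s : 𝕂), x)) (1, 0) 0 := by
      refine HasDerivAt.prodMk ?_ (hasDerivAt_const _ _)
      simpa using (RCLike.ofRealCLM (K := 𝕂)).hasDerivAt (x := (0 : ℝ))
    have h5 : HasFDerivAt Ψ ((fderiv 𝕂 Ψ (0, x)).restrictScalars ℝ) (((0 : ℝ) : 𝕂), x) := by
      simpa using (hpart _ h2).restrictScalars ℝ
    rw [h3] at h1
    exact (h5.comp_hasDerivAt (0 : ℝ) h4).unique h1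
  have hspace : ∀ᶠ s : ℝ in 𝓝 0, ∀ v, fderiv 𝕂 Ψ ((s : 𝕂), 0) (0, v) = v := by
    filter_upwards [Metric.ball_mem_nhds 0 hδ, hofReal.eventually hΦ1] with s hs h1 v
    obtain ⟨-, ⟨h2, -⟩, -⟩ := hb _ (hmem s hs 0 (Metric.mem_ball_self hδ))
    have h3 : HasFDerivAt (fun x => Ψ ((s : 𝕂), x)) (.id 𝕂 _) 0 := by
      refine h1.2.congr_of_eventuallyEq ?_
      filter_upwards [Metric.ball_mem_nhds 0 hδ] with x hx using hflow s hs x hx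
    have h4 := (hpart _ h2).comp (0 : Fin p → 𝕂) (hasFDerivAt_prodMk_right (s : 𝕂) 0)
    exact congrArg (fun A : (Fin p → 𝕂) →L[𝕂] (Fin p → 𝕂) => A v) (h4.unique h3)
  have hΨ' : ContDiffAt 𝕂 r.order (fderiv 𝕂 Ψ) (0, 0) := hΨs0.fderiv_right r.order_add_one
  have hD : HasFDerivAt (fderiv 𝕂 Ψ) (fderiv 𝕂 (fderiv 𝕂 Ψ) (0, 0)) (0, 0) :=
    (hΨ'.differentiableAt r.order_ne_zero).hasFDerivAt
  refine ⟨?_, ?_⟩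
  · rw [← htime 0 (Metric.mem_ball_self hδ)]
    have h5 : HasFDerivAt Ψ ((fderiv 𝕂 Ψ (0, 0)).restrictScalars ℝ)
        (((0 : ℝ) : 𝕂), (0 : Fin p → 𝕂)) := by
      simpa using (hpart _ hΨs0).restrictScalars ℝ
    refine (h5.comp_hasDerivAt (0 : ℝ) hcurve).unique
      ((hasDerivAt_const (0 : ℝ) (0 : Fin p → 𝕂)).congr_of_eventuallyEq ?_)
    filter_upwards [Metric.ball_mem_nhds 0 hδ, hofReal.eventually hΦ1] with s hs h1
    exact (hflow s hs 0 (Metric.mem_ball_self hδ)).trans h1.1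
  · have hsymm := hΨs0.isSymmSndFDerivAt (by simpa using r.coe_le_order 2)
    ext1 v
    have h6 : fderiv 𝕂 (fderiv 𝕂 Ψ) (0, 0) (1, 0) (0, v) = 0 := by
      have h7 : HasFDerivAt (fderiv 𝕂 Ψ) ((fderiv 𝕂 (fderiv 𝕂 Ψ) (0, 0)).restrictScalars ℝ)
          (((0 : ℝ) : 𝕂), (0 : Fin p → 𝕂)) := by
        simpa using hD.restrictScalars ℝ
      have h8 := h7.comp_hasDerivAt (0 : ℝ) hcurve
      have h9 : HasFDerivAt (fun A : 𝕂 × (Fin p → 𝕂) →L[𝕂] (Fin p → 𝕂) => A (0, v))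
          ((ContinuousLinearMap.apply 𝕂 (Fin p → 𝕂) ((0 : 𝕂), v)).restrictScalars ℝ)
          (fderiv 𝕂 Ψ (((0 : ℝ) : 𝕂), 0)) :=
        (ContinuousLinearMap.apply 𝕂 (Fin p → 𝕂) ((0 : 𝕂), v)).hasFDerivAt.restrictScalars ℝ
      refine (h9.comp_hasDerivAt (0 : ℝ) h8).unique
        ((hasDerivAt_const (0 : ℝ) v).congr_of_eventuallyEq ?_)
      filter_upwards [hspace] with s hs using hs v
    have h10 : HasFDerivAt Y ((ContinuousLinearMap.apply 𝕂 (Fin p → 𝕂) ((1 : 𝕂), (0 : Fin p → 𝕂))).comp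
        ((fderiv 𝕂 (fderiv 𝕂 Ψ) (0, 0)).comp (.inr 𝕂 𝕂 _))) 0 := by
      have h11 := (ContinuousLinearMap.apply 𝕂 (Fin p → 𝕂)
        ((1 : 𝕂), (0 : Fin p → 𝕂))).hasFDerivAt.comp (0 : Fin p → 𝕂)
          (hD.comp (0 : Fin p → 𝕂) (hasFDerivAt_prodMk_right (0 : 𝕂) 0))
      refine h11.congr_of_eventuallyEq ?_
      filter_upwards [Metric.ball_mem_nhds 0 hδ] with x hx using (htime x hx).symm
    rw [h10.fderiv]
    have h12 := hsymm (0, v) (1, 0)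
    exact h12.trans h6

end Fields

/-! ### Solving the infinitesimal equation along the path `H + tΔ`. -/

section Deformation

theorem SmoothNear.eventually_comp_snd {𝕂 : Type*} [RCLike 𝕂] {E G : Type*}
    [NormedAddCommGroup E] [NormedSpace 𝕂 E] [NormedAddCommGroup G] [NormedSpace 𝕂 G]
    {r : Regularity} {f : E → G} (hf : SmoothNear 𝕂 r f) (t : 𝕂) :
    ∀ᶠ z : 𝕂 × E in 𝓝 (t, 0), ContDiffAt 𝕂 r.order (fun z : 𝕂 × E => f z.2) z :=
  ((continuous_snd.tendsto (t, (0 : E))).eventually hf).mono fun z hz => hz.comp z contDiffAt_snd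

/-- If the generators `e` are, modulo terms of higher order, infinitesimal contact equivalences
along `H`, then adding to `H` a combination of the generators of high enough order does not change
the equivalence class. -/
theorem contactEquivalent_add {𝕂 : Type*} [RCLike 𝕂] {E F : Type*} [NormedAddCommGroup E]
    [NormedSpace 𝕂 E] [NormedSpace ℝ E] [IsScalarTower ℝ 𝕂 E] [FiniteDimensional ℝ E]
    [NormedAddCommGroup F] [NormedSpace 𝕂 F] [NormedSpace ℝ F] [IsScalarTower ℝ 𝕂 F]
    [CompleteSpace F] {r : Regularity} {V : Set E} {ι : Type*} [Fintype ι] [DecidableEq ι]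
    {H Δ : E → F} {e : ι → E → F} {X : ι → E → E} {W : ι → E → F →L[𝕂] F}
    {C₀ C₁ : ι → ι → E → 𝕂} {d : ι → E → 𝕂}
    (hH : SmoothNear 𝕂 r H) (hΔ : SmoothNear 𝕂 r Δ) (hX : ∀ a, SmoothNear 𝕂 r (X a))
    (hW : ∀ a, SmoothNear 𝕂 r (W a)) (hC₀ : ∀ a b, SmoothNear 𝕂 r (C₀ a b))
    (hC₁ : ∀ a b, SmoothNear 𝕂 r (C₁ a b)) (hd : ∀ a, SmoothNear 𝕂 r (d a))
    (hX0 : ∀ a, X a 0 = 0) (hC₀0 : ∀ a b, C₀ a b 0 = 0) (hC₁0 : ∀ a b, C₁ a b 0 = 0)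
    (hV : ∀ a, ∀ᶠ x in 𝓝 0, ∀ u : 𝕂, Invariant (fun x => u • X a x) V x)
    (he : ∀ a, ∀ᶠ x in 𝓝 0, e a x =
      fderiv 𝕂 H x (X a x) + W a x (H x) + ∑ b, C₀ a b x • e b x)
    (hΔe : ∀ a, ∀ᶠ x in 𝓝 0, fderiv 𝕂 Δ x (X a x) + W a x (Δ x) = ∑ b, C₁ a b x • e b x)
    (hΔd : ∀ᶠ x in 𝓝 0, Δ x = ∑ a, d a x • e a x) :
    ContactEquivalent 𝕂 r V H (fun x => H x + Δ x) := by
  have : CompleteSpace E := FiniteDimensional.complete ℝ E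
  suffices h : ContactEquivalent 𝕂 r V (fun x => H x + ((0 : ℝ) : 𝕂) • Δ x)
      (fun x => H x + ((1 : ℝ) : 𝕂) • Δ x) by simpa using h
  refine ContactEquivalent.of_locally (H := fun (t : ℝ) x => H x + (t : 𝕂) • Δ x) zero_le_one
    fun t _ => ?_
  have hsnd : Tendsto (fun z : 𝕂 × E => z.2) (𝓝 ((t : 𝕂), 0)) (𝓝 0) := continuous_snd.tendsto _
  let S (a b : ι) : (ι → 𝕂) →L[𝕂] (ι → 𝕂) :=
    (ContinuousLinearMap.single 𝕂 (fun _ : ι => 𝕂) b).comp (.proj a)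
  -- The transpose of the matrix expressing `dH_t(X a) + W a H_t` in the generators `e`. The
  -- coefficients `C₀` and `C₁` vanish at the origin, so `T` is the identity at `(t, 0)` and `α`
  -- solves `T α = d` nearby.
  let T : 𝕂 × E → (ι → 𝕂) →L[𝕂] (ι → 𝕂) := fun z =>
    1 - ∑ a, ∑ b, (C₀ a b z.2 - z.1 * C₁ a b z.2) • S a b
  have hT0 : T ((t : 𝕂), 0) = 1 := by
    refine (congrArg (fun A => 1 - A) (Finset.sum_eq_zero fun a _ => Finset.sum_eq_zero fun b _ => ?_)).trans
      (sub_zero _)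
    rw [hC₀0, hC₁0, mul_zero, sub_zero]
    exact zero_smul 𝕂 (S a b)
  have hT : ∀ᶠ z in 𝓝 ((t : 𝕂), 0), ContDiffAt 𝕂 r.order T z := by
    filter_upwards [eventually_all.2 fun a => eventually_all.2 fun b => (hC₀ a b).eventually_comp_snd _,
      eventually_all.2 fun a => eventually_all.2 fun b => (hC₁ a b).eventually_comp_snd _] with z h0 h1
    exact contDiffAt_const.sub (ContDiffAt.sum fun a _ => ContDiffAt.sum fun b _ =>
      ((h0 a b).sub (contDiffAt_fst.mul (h1 a b))).smul contDiffAt_const)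
  have hTu : ∀ᶠ z in 𝓝 ((t : 𝕂), 0), IsUnit (T z) :=
    hT.self_of_nhds.continuousAt.eventually_mem (Units.isOpen.mem_nhds (by simp [hT0]))
  let α : 𝕂 × E → ι → 𝕂 := fun z => Ring.inverse (T z) fun a => d a z.2
  have hα : ∀ᶠ z in 𝓝 ((t : 𝕂), 0), ContDiffAt 𝕂 r.order α z := by
    filter_upwards [hT, hTu, eventually_all.2 fun a => (hd a).eventually_comp_snd _] with z h1 ⟨u, hu⟩ h2
    have h3 : ContDiffAt 𝕂 r.order Ring.inverse (T z) := by
      rw [← hu]; exact contDiffAt_ringInverse 𝕂 u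
    exact (h3.comp z h1).clm_apply (contDiffAt_pi.2 h2)
  have hαi (a : ι) : ∀ᶠ z in 𝓝 ((t : 𝕂), 0), ContDiffAt 𝕂 r.order (fun z => -α z a) z :=
    hα.mono fun z hz => (contDiffAt_pi.1 hz a).neg
  have hαT : ∀ᶠ z in 𝓝 ((t : 𝕂), 0), ∀ b,
      d b z.2 = α z b - ∑ a, (C₀ a b z.2 - z.1 * C₁ a b z.2) * α z a := by
    filter_upwards [hTu] with z hz b
    have h1 : T z (α z) = fun a => d a z.2 := apply_ringInverse_apply hz _
    rw [← congrFun h1 b]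
    simp [T, S, Pi.single_apply, Finset.sum_apply]
  let 𝓗 : 𝕂 × E → F := fun z => H z.2 + z.1 • Δ z.2
  let η : 𝕂 × E → E := fun z => ∑ a, (-α z a) • X a z.2
  let B : 𝕂 × E → F →L[𝕂] F := fun z => ∑ a, α z a • W a z.2
  have key := exists_equivalence_of_infinitesimal (𝕂 := 𝕂) r (t₀ := (t : 𝕂)) (𝓗 := 𝓗) (η := η)
    (B := B) (V := V) ?_ ?_ ?_ ?_ ?_ ?_
  · filter_upwards [key] with τ hτ
    simp only [RCLike.ofReal_add]
    exact hτ
  · filter_upwards [hH.eventually_comp_snd _, hΔ.eventually_comp_snd _] with z h1 h2 using h1.add (contDiffAt_fst.smul h2)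
  · filter_upwards [eventually_all.2 hαi, eventually_all.2 fun a => (hX a).eventually_comp_snd _] with z h1 h2
    exact ContDiffAt.sum fun a _ => (h1 a).smul (h2 a)
  · exact .of_forall fun s => by simp [η, hX0]
  · filter_upwards [hα, eventually_all.2 fun a => (hW a).eventually_comp_snd _] with z h1 h2
    exact ContDiffAt.sum fun a _ => (contDiffAt_pi.1 h1 a).smul (h2 a)
  · filter_upwards [hαT, hsnd.eventually hH, hsnd.eventually hΔ,
      hsnd.eventually (eventually_all.2 he), hsnd.eventually (eventually_all.2 hΔe),
      hsnd.eventually hΔd] with z h1 h2 h3 h4 h5 h6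
    have hH' := (h2.differentiableAt r.order_ne_zero).hasFDerivAt.comp z
      (hasFDerivAt_snd (𝕜 := 𝕂) (p := z))
    have hΔ' := (h3.differentiableAt r.order_ne_zero).hasFDerivAt.comp z
      (hasFDerivAt_snd (𝕜 := 𝕂) (p := z))
    have h7 := hH'.add ((hasFDerivAt_fst (𝕜 := 𝕂) (p := z)).smul hΔ')
    have h8 : HasFDerivAt 𝓗 _ z := h7
    have h9 (a : ι) : fderiv 𝕂 H z.2 (X a z.2) + z.1 • fderiv 𝕂 Δ z.2 (X a z.2) +
        W a z.2 (𝓗 z) = e a z.2 - ∑ b, (C₀ a b z.2 - z.1 * C₁ a b z.2) • e b z.2 := by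
      have h10 : ∑ b, (C₀ a b z.2 - z.1 * C₁ a b z.2) • e b z.2 =
          ∑ b, C₀ a b z.2 • e b z.2 - z.1 • ∑ b, C₁ a b z.2 • e b z.2 := by
        simp only [sub_smul, mul_smul, Finset.sum_sub_distrib, Finset.smul_sum]
      rw [h10, ← h5 a]
      nth_rewrite 1 [h4 a]
      simp only [𝓗, map_add, map_smul, smul_add]
      abel
    -- Interchanging the sums turns `T α = d` into the required expression of `Δ`. Moving the vector
    -- field term to the other side explains the minus sign in `η`.
    have h11 : Δ z.2 = ∑ a, α z a • (fderiv 𝕂 H z.2 (X a z.2) +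
        z.1 • fderiv 𝕂 Δ z.2 (X a z.2) + W a z.2 (𝓗 z)) := by
      simp only [h9, smul_sub, Finset.sum_sub_distrib, Finset.smul_sum]
      rw [Finset.sum_comm, h6, ← Finset.sum_sub_distrib]
      refine Finset.sum_congr rfl fun b _ => ?_
      rw [h1 b, sub_smul, Finset.sum_smul]
      congr 1
      exact Finset.sum_congr rfl fun a _ => by rw [smul_smul, mul_comm]
    have h12 : fderiv 𝕂 𝓗 z (1, η z) = fderiv 𝕂 H z.2 (η z) + z.1 • fderiv 𝕂 Δ z.2 (η z) +
        Δ z.2 := by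
      rw [h8.fderiv]
      simp [add_assoc]
    rw [h12]
    rw [h11]
    simp only [η, B, map_sum, map_smul, Finset.smul_sum, sum_apply,
      smul_apply]
    rw [← Finset.sum_add_distrib, ← Finset.sum_add_distrib]
    refine Finset.sum_congr rfl fun a _ => ?_
    simp only [smul_add, neg_smul, smul_neg, smul_comm z.1 (α z a)]
    abel
  · exact invariant_suspension hX hV hαi

end Deformation

/-! ### Vanishing derivatives and order of growth. -/

section Order

universe u

theorem isBigO_pow_succ_of_fderiv {𝕂 : Type*} [RCLike 𝕂] {E G : Type*} [NormedAddCommGroup E]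
    [NormedSpace 𝕂 E] [NormedAddCommGroup G] [NormedSpace 𝕂 G] {F : E → G} {k : ℕ}
    (hF : ∀ᶠ x in 𝓝 0, DifferentiableAt 𝕂 F x) (h0 : F 0 = 0)
    (h : fderiv 𝕂 F =O[𝓝 0] fun x => ‖x‖ ^ k) : F =O[𝓝 0] fun x => ‖x‖ ^ (k + 1) := by
  let _ : NormedSpace ℝ E := NormedSpace.restrictScalars ℝ 𝕂 E
  obtain ⟨C, hC⟩ := h.bound
  obtain ⟨δ, hδ, hb⟩ := Metric.eventually_nhds_iff_ball.1 (hF.and hC)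
  refine Asymptotics.IsBigO.of_bound C ?_
  filter_upwards [Metric.ball_mem_nhds 0 hδ] with x hx
  have hsub : ∀ y ∈ Metric.closedBall (0 : E) ‖x‖, y ∈ Metric.ball (0 : E) δ := fun y hy => by
    rw [mem_closedBall_zero_iff] at hy
    rw [mem_ball_zero_iff] at hx ⊢
    exact hy.trans_lt hx
  -- The constant from the bound may be negative, but only if no nonzero point is available.
  have hC0 : 0 ≤ C ∨ x = 0 := by
    by_cases hx0 : x = 0
    · exact .inr hx0
    · left
      have h1 := (norm_nonneg _).trans (hb x hx).2
      rw [norm_pow, norm_norm] at h1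
      exact nonneg_of_mul_nonneg_left h1 (by positivity)
  rcases hC0 with hC0 | rfl
  · have h1 := (convex_closedBall (0 : E) ‖x‖).norm_image_sub_le_of_norm_fderiv_le (𝕜 := 𝕂)
      (f := F) (C := C * ‖x‖ ^ k) (fun y hy => (hb y (hsub y hy)).1) (fun y hy => ?_)
      (Metric.mem_closedBall_self (norm_nonneg _)) (mem_closedBall_zero_iff.2 le_rfl)
    · rw [h0, sub_zero, sub_zero] at h1
      rw [norm_pow, norm_norm, pow_succ, ← mul_assoc]
      exact h1
    · refine (hb y (hsub y hy)).2.trans ?_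
      rw [norm_pow, norm_norm]
      rw [mem_closedBall_zero_iff] at hy
      gcongr
  · simp [h0]

/-- Induction through the derivative: its estimate has order one less, and the mean value inequality
recovers the missing factor `‖x‖`. The target changes to `E →L[𝕂] G` at each step. -/
theorem isBigO_of_iteratedFDeriv_eq_zero {𝕂 : Type*} [RCLike 𝕂] {E : Type u}
    [NormedAddCommGroup E] [NormedSpace 𝕂 E] (k : ℕ) {G : Type u} [NormedAddCommGroup G]
    [NormedSpace 𝕂 G] {F : E → G} (hF : ∀ᶠ x in 𝓝 0, ContDiffAt 𝕂 k F x)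
    (h : ∀ i < k, iteratedFDeriv 𝕂 i F 0 = 0) : F =O[𝓝 0] fun x => ‖x‖ ^ k := by
  induction k generalizing G with
  | zero =>
    simpa using hF.self_of_nhds.continuousAt.norm.isBoundedUnder_le.isBigO_one ℝ
  | succ k ih =>
    refine isBigO_pow_succ_of_fderiv (𝕂 := 𝕂)
      (hF.mono fun x hx => hx.differentiableAt (by simp)) ?_ (ih ?_ fun i hi => ?_)
    · have := h 0 (Nat.succ_pos k)
      rw [← norm_eq_zero, norm_iteratedFDeriv_zero] at this
      exact norm_eq_zero.1 this
    · exact hF.mono fun x hx => hx.fderiv_right (by simp)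
    · rw [← norm_eq_zero, norm_iteratedFDeriv_fderiv, h (i + 1) (Nat.succ_lt_succ hi), norm_zero]

end Order

/-! ### Powers of the maximal ideal as orders of vanishing. -/

section Algebra

universe u

variable {𝕂 : Type u} [RCLike 𝕂] {r : Regularity} {p q : ℕ}

/-- The germ of a smooth function. -/
def SmoothGerm.mk {F : (Fin p → 𝕂) → 𝕂} (hF : SmoothNear 𝕂 r F) : SmoothGerm 𝕂 r p :=
  ⟨(F : Germ (𝓝 (0 : Fin p → 𝕂)) 𝕂), F, hF, rfl⟩

/-- The function `F` represents the germ `f`. -/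
def SmoothGerm.IsRep (f : SmoothGerm 𝕂 r p) (F : (Fin p → 𝕂) → 𝕂) : Prop :=
  f.1 = (F : Germ (𝓝 (0 : Fin p → 𝕂)) 𝕂)

namespace SmoothGerm

theorem exists_isRep (f : SmoothGerm 𝕂 r p) : ∃ F, IsRep f F :=
  let ⟨F, _, h⟩ := f.2
  ⟨F, h⟩

theorem isRep_mk {F : (Fin p → 𝕂) → 𝕂} (hF : SmoothNear 𝕂 r F) :
    IsRep (mk hF : SmoothGerm 𝕂 r p) F := rfl

namespace IsRep

variable {f g : SmoothGerm 𝕂 r p} {F G : (Fin p → 𝕂) → 𝕂}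

theorem eventuallyEq (h1 : IsRep f F) (h2 : IsRep f G) : F =ᶠ[𝓝 0] G :=
  Germ.coe_eq.1 (Eq.trans (Eq.symm h1) h2)

theorem ext (h1 : IsRep f F) (h2 : IsRep g G) (h : F =ᶠ[𝓝 0] G) : f = g :=
  Subtype.ext (Eq.trans h1 ((Germ.coe_eq.2 h).trans (Eq.symm h2)))

theorem congr (h1 : IsRep f F) (h : F =ᶠ[𝓝 0] G) : IsRep f G :=
  Eq.trans h1 (Germ.coe_eq.2 h)

theorem smoothNear (h : IsRep f F) : SmoothNear 𝕂 r F := by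
  obtain ⟨G, hG, hGe⟩ := f.2
  filter_upwards [hG, (h.eventuallyEq hGe).eventually_nhds] with x h3 h4
  exact h3.congr_of_eventuallyEq h4

theorem add (h1 : IsRep f F) (h2 : IsRep g G) : IsRep (f + g) fun x => F x + G x := by
  change f.1 + g.1 = _
  rw [h1, h2]
  rfl

theorem sub (h1 : IsRep f F) (h2 : IsRep g G) : IsRep (f - g) fun x => F x - G x := by
  change f.1 - g.1 = _
  rw [h1, h2]
  rfl

theorem mul (h1 : IsRep f F) (h2 : IsRep g G) : IsRep (f * g) fun x => F x * G x := by
  change f.1 * g.1 = _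
  rw [h1, h2]
  rfl

theorem zero : IsRep (0 : SmoothGerm 𝕂 r p) fun _ => 0 := rfl

theorem one : IsRep (1 : SmoothGerm 𝕂 r p) fun _ => 1 := rfl

theorem sum {ι : Type*} (s : Finset ι) {f : ι → SmoothGerm 𝕂 r p} {F : ι → (Fin p → 𝕂) → 𝕂}
    (h : ∀ i, IsRep (f i) (F i)) : IsRep (∑ i ∈ s, f i) fun x => ∑ i ∈ s, F i x := by
  classical
  induction s using Finset.induction_on with
  | empty => simpa using zero
  | insert a s ha ih => simpa only [Finset.sum_insert ha] using (h a).add ih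

theorem prod {ι : Type*} (s : Finset ι) {f : ι → SmoothGerm 𝕂 r p} {F : ι → (Fin p → 𝕂) → 𝕂}
    (h : ∀ i, IsRep (f i) (F i)) : IsRep (∏ i ∈ s, f i) fun x => ∏ i ∈ s, F i x := by
  classical
  induction s using Finset.induction_on with
  | empty => simpa using one
  | insert a s ha ih => simpa only [Finset.prod_insert ha] using (h a).mul ih

theorem pderiv (h : IsRep f F) (j : Fin p) :
    IsRep (pderiv j f) fun x => fderiv 𝕂 F x (Pi.single j 1) := by
  obtain ⟨f, hf⟩ := f
  change f = _ at h
  subst h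
  rfl

theorem mem_maxIdeal_iff (h : IsRep f F) : f ∈ maxIdeal 𝕂 r p ↔ F 0 = 0 := by
  change Germ.value f.1 = 0 ↔ _
  rw [h]
  rfl

end IsRep

/-- The germ of a constant function. -/
def const (c : 𝕂) : SmoothGerm 𝕂 r p := mk (F := fun _ => c) (.of_forall fun _ => contDiffAt_const)

/-- The germ of a coordinate function. -/
def coord (j : Fin p) : SmoothGerm 𝕂 r p :=
  mk (F := fun x => x j) (.of_forall fun x => contDiffAt_apply 𝕂 𝕂 j x)

/-- The monomial germs of degree `k`. -/
def monomial {k : ℕ} (a : Fin k → Fin p) : SmoothGerm 𝕂 r p := ∏ i, coord (a i)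

theorem isRep_const (c : 𝕂) : IsRep (const c : SmoothGerm 𝕂 r p) fun _ => c := rfl

theorem isRep_coord (j : Fin p) : IsRep (coord j : SmoothGerm 𝕂 r p) fun x => x j := rfl

theorem isRep_monomial {k : ℕ} (a : Fin k → Fin p) :
    IsRep (monomial a : SmoothGerm 𝕂 r p) fun x => ∏ i, x (a i) :=
  IsRep.prod _ fun i => isRep_coord (a i)

theorem exists_sum_mul_coord {F : (Fin p → 𝕂) → 𝕂} (hF : SmoothNear 𝕂 r F) (h0 : F 0 = 0) :
    ∃ g : Fin p → (Fin p → 𝕂) → 𝕂, (∀ j, SmoothNear 𝕂 r (g j)) ∧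
      ∀ᶠ x in 𝓝 0, F x = ∑ j, g j x * x j := by
  obtain ⟨g, hg, hFg⟩ := hadamard r hF
  refine ⟨fun j x => g x (Pi.single j 1),
    fun j => hg.mono fun x hx => hx.clm_apply contDiffAt_const, ?_⟩
  filter_upwards [hFg] with x hx
  rw [hx, h0, zero_add]
  have h1 := congrArg (g x) (pi_eq_sum_univ' x)
  rw [h1]
  simp [mul_comm]

theorem maxIdeal_eq_span : maxIdeal 𝕂 r p = Ideal.span (range coord) := by
  refine le_antisymm (fun f hf => ?_) (Ideal.span_le.2 ?_)
  · obtain ⟨F, hF⟩ := exists_isRep f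
    obtain ⟨g, hg, hFg⟩ := exists_sum_mul_coord hF.smoothNear (hF.mem_maxIdeal_iff.1 hf)
    have h1 : f = ∑ j, mk (hg j) * coord j :=
      hF.ext (.sum _ fun j => (isRep_mk (hg j)).mul (isRep_coord j)) hFg
    rw [h1]
    exact sum_mem fun j _ => Ideal.mul_mem_left _ _ (Ideal.subset_span ⟨j, rfl⟩)
  · rintro _ ⟨j, rfl⟩
    exact (isRep_coord j).mem_maxIdeal_iff.2 rfl

/-- Monomials are indexed by words in the coordinates, so they repeat; only generation is needed,
not independence. -/
theorem maxIdeal_pow_eq_span (k : ℕ) :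
    maxIdeal 𝕂 r p ^ k = Ideal.span (range fun a : Fin k → Fin p => monomial a) := by
  rw [maxIdeal_eq_span]
  refine (Submodule.span_pow (R := SmoothGerm 𝕂 r p) _ k).trans ?_
  congr 1
  ext f
  rw [Set.mem_pow]
  constructor
  · rintro ⟨g, rfl⟩
    choose a ha using fun i => (g i).2
    refine ⟨a, ?_⟩
    simp [monomial, ha, List.prod_ofFn]
  · rintro ⟨a, rfl⟩
    exact ⟨fun i => ⟨coord (a i), a i, rfl⟩, by simp [monomial, List.prod_ofFn]⟩

theorem mem_maxIdeal_pow_iff {k : ℕ} {f : SmoothGerm 𝕂 r p} :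
    f ∈ maxIdeal 𝕂 r p ^ k ↔ ∃ c : (Fin k → Fin p) → SmoothGerm 𝕂 r p,
      f = ∑ a, c a * monomial a := by
  rw [maxIdeal_pow_eq_span, Ideal.mem_span_range_iff_exists_fun]
  simp only [eq_comm]

theorem sum_mul_monomial_mem {k : ℕ} {c : (Fin k → Fin p) → SmoothGerm 𝕂 r p}
    (hc : ∀ a, c a ∈ maxIdeal 𝕂 r p) : ∑ a, c a * monomial a ∈ maxIdeal 𝕂 r p ^ (k + 1) := by
  refine sum_mem fun a _ => ?_
  rw [pow_succ']
  refine Ideal.mul_mem_mul (hc a) ?_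
  rw [maxIdeal_pow_eq_span]
  exact Ideal.subset_span ⟨a, rfl⟩

theorem mem_maxIdeal_pow_succ_iff {k : ℕ} {f : SmoothGerm 𝕂 r p} :
    f ∈ maxIdeal 𝕂 r p ^ (k + 1) ↔ ∃ c : (Fin k → Fin p) → SmoothGerm 𝕂 r p,
      (∀ a, c a ∈ maxIdeal 𝕂 r p) ∧ f = ∑ a, c a * monomial a := by
  constructor
  · intro h
    rw [pow_succ', maxIdeal_pow_eq_span k, ← smul_eq_mul] at h
    obtain ⟨c, hc, h1⟩ := (Submodule.mem_ideal_smul_span_iff_exists_sum _ _ _).1 h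
    refine ⟨c, hc, ?_⟩
    rw [← h1, Finsupp.sum_fintype _ _ (by simp)]
    simp
  · rintro ⟨c, hc, rfl⟩
    exact sum_mul_monomial_mem hc

theorem isBigO_monomial {k : ℕ} (a : Fin k → Fin p) :
    (fun x : Fin p → 𝕂 => ∏ i, x (a i)) =O[𝓝 0] fun x => ‖x‖ ^ k := by
  refine Asymptotics.IsBigO.of_bound 1 (.of_forall fun x => ?_)
  rw [norm_prod, one_mul, norm_pow, norm_norm]
  refine (Finset.prod_le_prod (fun i _ => norm_nonneg _) fun i _ => norm_le_pi_norm x (a i)).trans ?_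
  simp

theorem isBigO_of_mem_maxIdeal_pow {k : ℕ} {f : SmoothGerm 𝕂 r p} {F : (Fin p → 𝕂) → 𝕂}
    (hF : IsRep f F) (h : f ∈ maxIdeal 𝕂 r p ^ k) : F =O[𝓝 0] fun x => ‖x‖ ^ k := by
  obtain ⟨c, rfl⟩ := mem_maxIdeal_pow_iff.1 h
  choose C hC using fun a => exists_isRep (c a)
  refine (hF.eventuallyEq (.sum _ fun a => (hC a).mul (isRep_monomial a))).trans_isBigO ?_
  refine Asymptotics.IsBigO.fun_sum fun a _ => ?_
  have h1 : C a =O[𝓝 0] fun _ => (1 : ℝ) :=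
    (hC a).smoothNear.self_of_nhds.continuousAt.norm.isBoundedUnder_le.isBigO_one ℝ
  simpa using h1.mul (isBigO_monomial a)

/-- Along a line, `P x = s⁻ᵏ P (s x) = O(|s|)`; let `s` tend to `0`. -/
theorem eq_zero_of_homogeneous_of_isBigO {k : ℕ} {P : (Fin p → 𝕂) → 𝕂}
    (hP : ∀ (s : 𝕂) x, P (s • x) = s ^ k * P x) (h : P =O[𝓝 0] fun x => ‖x‖ ^ (k + 1))
    (x : Fin p → 𝕂) : P x = 0 := by
  have h1 : Tendsto (fun s : 𝕂 => s • x) (𝓝[≠] 0) (𝓝 0) :=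
    (Continuous.tendsto' (by fun_prop : Continuous fun s : 𝕂 => s • x) _ _
      (zero_smul 𝕂 x)).mono_left nhdsWithin_le_nhds
  have h2 := h.comp_tendsto h1
  have h3 : (fun _ : 𝕂 => P x) =O[𝓝[≠] 0] fun s : 𝕂 => ‖s‖ * ‖x‖ ^ (k + 1) := by
    have h4 : (fun s : 𝕂 => (s ^ k)⁻¹) =O[𝓝[≠] 0] fun s : 𝕂 => (‖s‖ ^ k)⁻¹ :=
      Asymptotics.IsBigO.of_bound 1 (.of_forall fun s => by simp)
    refine ((h4.mul h2).congr' ?_ ?_)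
    · filter_upwards [self_mem_nhdsWithin] with s hs
      have hs' : s ≠ 0 := hs
      simp only [Function.comp_apply, hP]
      field_simp
    · filter_upwards [self_mem_nhdsWithin] with s hs
      have hs' : ‖s‖ ≠ 0 := norm_ne_zero_iff.2 hs
      simp only [Function.comp_apply, norm_smul, mul_pow]
      field_simp
      ring
  have h5 : Tendsto (fun s : 𝕂 => ‖s‖ * ‖x‖ ^ (k + 1)) (𝓝[≠] 0) (𝓝 0) :=
    (Continuous.tendsto' (by fun_prop) _ _ (by simp)).mono_left nhdsWithin_le_nhds
  exact tendsto_nhds_unique tendsto_const_nhds (h3.trans_tendsto h5)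

/-- Inductively `f` is a combination of monomials of degree `k`. Freezing the coefficients at the
origin leaves a homogeneous polynomial plus an element of `𝔪^(k+1)`. The polynomial is too small to
be nonzero as a function, although its coefficients over repeated words need not vanish
individually. -/
theorem mem_maxIdeal_pow_of_isBigO {k : ℕ} {f : SmoothGerm 𝕂 r p} {F : (Fin p → 𝕂) → 𝕂}
    (hF : IsRep f F) (h : F =O[𝓝 0] fun x => ‖x‖ ^ k) : f ∈ maxIdeal 𝕂 r p ^ k := by
  induction k with
  | zero => simp
  | succ k ih =>
    have hpow : (fun x : Fin p → 𝕂 => ‖x‖ ^ (k + 1)) =O[𝓝 0] fun x => ‖x‖ ^ k := by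
      refine Asymptotics.IsBigO.of_bound 1 ?_
      filter_upwards [Metric.closedBall_mem_nhds 0 one_pos] with x hx
      rw [mem_closedBall_zero_iff] at hx
      rw [one_mul, norm_pow, norm_pow, norm_norm]
      exact pow_le_pow_of_le_one (norm_nonneg _) hx k.le_succ
    obtain ⟨c, rfl⟩ := mem_maxIdeal_pow_iff.1 (ih (h.trans hpow))
    choose C hC using fun a => exists_isRep (c a)
    let d : (Fin k → Fin p) → SmoothGerm 𝕂 r p := fun a => c a - const (C a 0)
    have hd (a) : d a ∈ maxIdeal 𝕂 r p :=
      ((hC a).sub (isRep_const (C a 0))).mem_maxIdeal_iff.2 (sub_self _)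
    have hsum := sum_mul_monomial_mem hd
    have hsplit : ∑ a, c a * monomial a =
        ∑ a, const (C a 0) * monomial a + ∑ a, d a * monomial a := by
      rw [← Finset.sum_add_distrib]
      exact Finset.sum_congr rfl fun a _ => by simp only [d]; ring
    let P : (Fin p → 𝕂) → 𝕂 := fun x => ∑ a : Fin k → Fin p, C a 0 * ∏ i, x (a i)
    have hP : IsRep (∑ a, const (C a 0) * monomial a : SmoothGerm 𝕂 r p) P :=
      .sum _ fun a => (isRep_const (C a 0)).mul (isRep_monomial a)
    obtain ⟨D, hD⟩ := exists_isRep (∑ a, d a * monomial a)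
    have hPO : P =O[𝓝 0] fun x => ‖x‖ ^ (k + 1) := by
      have h1 : P =ᶠ[𝓝 0] fun x => F x - D x := by
        filter_upwards [hF.eventuallyEq ((hP.add hD).congr .rfl |> fun h => hsplit ▸ h)] with x hx
        rw [hx]; ring
      exact h1.trans_isBigO (h.sub (isBigO_of_mem_maxIdeal_pow hD hsum))
    have hP0 : ∀ x, P x = 0 := eq_zero_of_homogeneous_of_isBigO (fun s x => by
      simp only [P, Pi.smul_apply, smul_eq_mul, Finset.prod_mul_distrib, Finset.prod_const,
        Finset.card_univ, Fintype.card_fin, Finset.mul_sum]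
      exact Finset.sum_congr rfl fun a _ => by ring) hPO
    rw [hsplit, hP.ext .zero (.of_forall hP0), zero_add]
    exact hsum

end SmoothGerm

end Algebra

/-! ### Tangent spaces, jets and determinacy. -/

section Determinacy

universe u

variable {𝕂 : Type u} [RCLike 𝕂] {r : Regularity} {p q : ℕ}

open SmoothGerm

theorem mem_idealTheta_iff {I : Ideal (SmoothGerm 𝕂 r p)} {f : Tuple 𝕂 r p q} :
    f ∈ idealTheta q I ↔ ∀ i, f i ∈ I := by
  constructor
  · intro h
    refine Submodule.smul_induction_on (p := fun f : Tuple 𝕂 r p q => ∀ i, f i ∈ I) h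
      (fun a ha g _ i => I.mul_mem_right _ ha) fun f g hf hg i => I.add_mem (hf i) (hg i)
  · intro h
    have h1 : f = ∑ i, f i • (Pi.single i 1 : Tuple 𝕂 r p q) := by
      ext1 j
      simp [Finset.sum_apply, Pi.single_apply]
    rw [h1]
    exact sum_mem fun i _ => Submodule.smul_mem_smul (h i) trivial

theorem Represents.map_zero {F : (Fin p → 𝕂) → (Fin q → 𝕂)} {f : Tuple 𝕂 r p q}
    (hF : Represents F f) (hf : ∀ i, f i ∈ maxIdeal 𝕂 r p) : F 0 = 0 :=
  funext fun i => (IsRep.mem_maxIdeal_iff (hF i)).1 (hf i)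

/-- Hadamard's lemma in the target writes `φ = ∑ g_j y_j`; composing with `h` gives `∑ (g_j ∘ h)
h_j`. -/
theorem pullbackMax_le_span {h : Tuple 𝕂 r p q} (h_zero : ∀ i, h i ∈ maxIdeal 𝕂 r p) :
    pullbackMax h ≤ Ideal.span (range h) := by
  refine Ideal.span_le.2 ?_
  rintro f ⟨φ, hφ, Φ, H, hΦ, hH, hf⟩
  have hΦ' : IsRep φ Φ := hΦ
  obtain ⟨g, hg, hΦg⟩ := exists_sum_mul_coord hΦ'.smoothNear (hΦ'.mem_maxIdeal_iff.1 hφ)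
  have hHs := hH.smoothNear
  have hHt : Tendsto H (𝓝 0) (𝓝 0) := by simpa [hH.map_zero h_zero] using hHs.tendsto
  have hgH (j : Fin q) : SmoothNear 𝕂 r (g j ∘ H) := by
    filter_upwards [hHs, hHt.eventually (hg j)] with x h1 h2 using h2.comp x h1
  have h1 : f = ∑ j, mk (hgH j) * h j := by
    refine IsRep.ext hf (.sum _ fun j => (isRep_mk (hgH j)).mul (hH j)) ?_
    exact hHt.eventually hΦg
  rw [h1]
  exact sum_mem fun j _ => Ideal.mul_mem_left _ _ (Ideal.subset_span ⟨j, rfl⟩)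

theorem exists_matrix_of_mem_idealTheta {h : Tuple 𝕂 r p q}
    (h_zero : ∀ i, h i ∈ maxIdeal 𝕂 r p) {J : Ideal (SmoothGerm 𝕂 r p)} {w : Tuple 𝕂 r p q}
    (hw : w ∈ idealTheta q (J * pullbackMax h)) :
    ∃ W : Fin q → Fin q → SmoothGerm 𝕂 r p, (∀ i m, W i m ∈ J) ∧
      ∀ i, w i = ∑ m, W i m * h m := by
  have h1 (i : Fin q) : ∃ W : Fin q → SmoothGerm 𝕂 r p, (∀ m, W m ∈ J) ∧
      w i = ∑ m, W m * h m := by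
    have h2 : w i ∈ J • Ideal.span (range h) :=
      Ideal.mul_mono_right (pullbackMax_le_span h_zero) (mem_idealTheta_iff.1 hw i)
    obtain ⟨c, hc, h3⟩ := (Submodule.mem_ideal_smul_span_iff_exists_sum _ _ _).1 h2
    refine ⟨c, hc, ?_⟩
    rw [← h3, Finsupp.sum_fintype _ _ (by simp)]
    simp
  choose W hW hwW using h1
  exact ⟨W, hW, hwW⟩

/-- The monomial vector fields along a map germ. -/
def monomialField {k : ℕ} (A : (Fin k → Fin p) × Fin q) : Tuple 𝕂 r p q :=
  fun i => if i = A.2 then monomial A.1 else 0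

/-- The functions representing the monomial vector fields. -/
def monomialFieldFun {k : ℕ} (A : (Fin k → Fin p) × Fin q) (x : Fin p → 𝕂) : Fin q → 𝕂 :=
  fun i => if i = A.2 then ∏ j, x (A.1 j) else 0

theorem represents_monomialField {k : ℕ} (A : (Fin k → Fin p) × Fin q) :
    Represents (monomialFieldFun A) (monomialField A : Tuple 𝕂 r p q) := by
  intro i
  by_cases h : i = A.2
  · simp only [monomialField, monomialFieldFun, h, if_true]
    exact isRep_monomial A.1
  · simp only [monomialField, monomialFieldFun, h, if_false]
    exact IsRep.zero

theorem sum_mul_monomialField {k : ℕ} (c : Fin q → (Fin k → Fin p) → SmoothGerm 𝕂 r p)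
    (i : Fin q) : ∑ A : (Fin k → Fin p) × Fin q, c A.2 A.1 * monomialField A i =
      ∑ a, c i a * monomial a := by
  rw [Fintype.sum_prod_type]
  simp [monomialField]

theorem exists_sum_monomialField {k : ℕ} {z : Tuple 𝕂 r p q}
    (hz : ∀ i, z i ∈ maxIdeal 𝕂 r p ^ k) :
    ∃ c : (Fin k → Fin p) × Fin q → SmoothGerm 𝕂 r p, ∀ i, z i = ∑ A, c A * monomialField A i := by
  choose c hc using fun i => mem_maxIdeal_pow_iff.1 (hz i)
  exact ⟨fun A => c A.2 A.1, fun i => by rw [sum_mul_monomialField, hc i]⟩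

theorem exists_sum_monomialField_succ {k : ℕ} {z : Tuple 𝕂 r p q}
    (hz : ∀ i, z i ∈ maxIdeal 𝕂 r p ^ (k + 1)) :
    ∃ c : (Fin k → Fin p) × Fin q → SmoothGerm 𝕂 r p, (∀ A, c A ∈ maxIdeal 𝕂 r p) ∧
      ∀ i, z i = ∑ A, c A * monomialField A i := by
  choose c hc hc' using fun i => mem_maxIdeal_pow_succ_iff.1 (hz i)
  exact ⟨fun A => c A.2 A.1, fun A => hc _ _, fun i => by rw [sum_mul_monomialField, hc' i]⟩

theorem monomialField_mem {k : ℕ} (A : (Fin k → Fin p) × Fin q) :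
    (monomialField A : Tuple 𝕂 r p q) ∈ idealTheta q (maxIdeal 𝕂 r p ^ k) := by
  refine mem_idealTheta_iff.2 fun i => ?_
  unfold monomialField
  split_ifs
  · rw [maxIdeal_pow_eq_span]
    exact Ideal.subset_span ⟨A.1, rfl⟩
  · exact zero_mem _

theorem Represents.applyField {X : (Fin p → 𝕂) → (Fin p → 𝕂)} {ξ : Tuple 𝕂 r p p}
    {H : (Fin p → 𝕂) → (Fin q → 𝕂)} {h : Tuple 𝕂 r p q} (hX : Represents X ξ)
    (hH : Represents H h) : Represents (fun x => fderiv 𝕂 H x (X x)) (applyField ξ h) := by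
  intro i
  have h1 : IsRep (VK.applyField ξ h i) _ :=
    IsRep.sum Finset.univ fun j => IsRep.mul (hX j) (IsRep.pderiv (hH i) j)
  refine h1.congr ?_
  filter_upwards [hH.smoothNear] with x hx
  have h2 := (hasFDerivAt_pi'.1 (hx.differentiableAt r.order_ne_zero).hasFDerivAt i).fderiv
  rw [h2]
  have h3 := congrArg (fun v => fderiv 𝕂 H x v i) (pi_eq_sum_univ' (X x))
  simp only [map_sum, map_smul, Finset.sum_apply, Pi.smul_apply, smul_eq_mul] at h3
  rw [h3]
  simp

/-- The linear map with the given matrix. -/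
noncomputable def matrixMap (W : Fin q → Fin q → 𝕂) : (Fin q → 𝕂) →L[𝕂] (Fin q → 𝕂) :=
  ∑ i, ∑ m, W i m • (ContinuousLinearMap.single 𝕂 (fun _ : Fin q => 𝕂) i).comp (.proj m)

theorem matrixMap_apply (W : Fin q → Fin q → 𝕂) (y : Fin q → 𝕂) (i : Fin q) :
    matrixMap W y i = ∑ m, W i m * y m := by
  simp [matrixMap, Finset.sum_apply, Pi.single_apply]

theorem smoothNear_matrixMap {W : Fin q → Fin q → (Fin p → 𝕂) → 𝕂}
    (hW : ∀ i m, SmoothNear 𝕂 r (W i m)) : SmoothNear 𝕂 r fun x => matrixMap fun i m => W i m x := by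
  filter_upwards [eventually_all.2 fun i => eventually_all.2 fun m => hW i m] with x hx
  exact ContDiffAt.sum fun i _ => ContDiffAt.sum fun m _ => (hx i m).smul contDiffAt_const

/-- The common core of both parts. The tangent condition is used only on monomial fields, and the
last two hypotheses say that replacing `h` by `h + tΔ` perturbs it by terms of order `k + 1`. -/
theorem equivalent_of_tangent {k : ℕ} {V : Set (Fin p → 𝕂)} {J : Ideal (SmoothGerm 𝕂 r p)}
    {Θ : Set (Tuple 𝕂 r p p)} (hΘ : Θ ⊆ Theta r V) (hΘ0 : ∀ ξ ∈ Θ, ∀ j, ξ j ∈ maxIdeal 𝕂 r p)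
    {h g : Tuple 𝕂 r p q} (h_zero : ∀ i, h i ∈ maxIdeal 𝕂 r p)
    (hT : (idealTheta q (maxIdeal 𝕂 r p ^ k) : Set (Tuple 𝕂 r p q)) ⊆
      ((fun ξ => applyField ξ h) '' Θ + (idealTheta q (J * pullbackMax h) : Set (Tuple 𝕂 r p q))) +
        (idealTheta q (maxIdeal 𝕂 r p ^ (k + 1)) : Set (Tuple 𝕂 r p q)))
    (hg : ∀ i, (g - h) i ∈ maxIdeal 𝕂 r p ^ k)
    (hgΘ : ∀ ξ ∈ Θ, ∀ i, applyField ξ (g - h) i ∈ maxIdeal 𝕂 r p ^ (k + 1))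
    (hgJ : ∀ w ∈ J, ∀ i, w * (g - h) i ∈ maxIdeal 𝕂 r p ^ (k + 1)) : Equivalent V h g := by
  have hdec (A : (Fin k → Fin p) × Fin q) : ∃ ξ ∈ Θ, ∃ W : Fin q → Fin q → SmoothGerm 𝕂 r p,
      (∀ i m, W i m ∈ J) ∧ ∃ c : (Fin k → Fin p) × Fin q → SmoothGerm 𝕂 r p,
        (∀ B, c B ∈ maxIdeal 𝕂 r p) ∧ ∀ i, monomialField A i =
          applyField ξ h i + ∑ m, W i m * h m + ∑ B, c B * monomialField B i := by
    obtain ⟨_, ⟨_, ⟨ξ, hξ, rfl⟩, w, hw, rfl⟩, z, hz, heq⟩ := hT (monomialField_mem A)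
    obtain ⟨W, hW, hwW⟩ := exists_matrix_of_mem_idealTheta h_zero hw
    obtain ⟨c, hc, hzc⟩ := exists_sum_monomialField_succ (mem_idealTheta_iff.1 hz)
    refine ⟨ξ, hξ, W, hW, c, hc, fun i => ?_⟩
    rw [← hwW, ← hzc]
    exact (congrFun heq i).symm
  choose ξ hξ W hW c₀ hc₀ hdec using hdec
  -- The contribution of `g - h` has order `k + 1`, so its coefficients over the degree `k`
  -- monomials can be chosen in `𝔪`. This keeps the matrix to be inverted equal to the identity at
  -- the origin.
  have hdec₁ (A : (Fin k → Fin p) × Fin q) :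
      ∃ c : (Fin k → Fin p) × Fin q → SmoothGerm 𝕂 r p, (∀ B, c B ∈ maxIdeal 𝕂 r p) ∧
        ∀ i, applyField (ξ A) (g - h) i + ∑ m, W A i m * (g - h) m =
          ∑ B, c B * monomialField B i :=
    exists_sum_monomialField_succ
      (z := fun i => applyField (ξ A) (g - h) i + ∑ m, W A i m * (g - h) m)
      fun i => add_mem (hgΘ _ (hξ A) i) (sum_mem fun m _ => hgJ _ (hW A i m) m)
  choose c₁ hc₁ hdec₁ using hdec₁
  obtain ⟨d, hd⟩ := exists_sum_monomialField hg
  obtain ⟨H, hH⟩ := exists_represents h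
  obtain ⟨Δ, hΔ⟩ := exists_represents (g - h)
  choose X hX using fun A => exists_represents (ξ A)
  choose WF hWF using fun A i m => exists_isRep (W A i m)
  choose C₀ hC₀ using fun A B => exists_isRep (c₀ A B)
  choose C₁ hC₁ using fun A B => exists_isRep (c₁ A B)
  choose D hD using fun A => exists_isRep (d A)
  have hG : Represents (fun x => H x + Δ x) g := fun i => by
    have h1 : IsRep (h i + (g - h) i) _ := IsRep.add (hH i) (hΔ i)
    rwa [Pi.sub_apply, add_sub_cancel] at h1
  refine ContactEquivalent.equivalent hH hG (contactEquivalent_add (e := monomialFieldFun)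
    (X := X) (W := fun A x => matrixMap fun i m => WF A i m x) (C₀ := C₀) (C₁ := C₁) (d := D)
    hH.smoothNear hΔ.smoothNear (fun A => (hX A).smoothNear)
    (fun A => smoothNear_matrixMap fun i m => (hWF A i m).smoothNear)
    (fun A B => (hC₀ A B).smoothNear) (fun A B => (hC₁ A B).smoothNear)
    (fun A => (hD A).smoothNear) (fun A => (hX A).map_zero (hΘ0 _ (hξ A)))
    (fun A B => (hC₀ A B).mem_maxIdeal_iff.1 (hc₀ A B))
    (fun A B => (hC₁ A B).mem_maxIdeal_iff.1 (hc₁ A B))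
    (fun A => invariant_of_mem_Theta (hΘ (hξ A)) (hX A)) (fun A => ?_) (fun A => ?_) ?_)
  · have h1 (i : Fin q) := IsRep.eventuallyEq (represents_monomialField A i) (hdec A i ▸
      IsRep.add (IsRep.add ((hX A).applyField hH i) (.sum Finset.univ fun m => (hWF A i m).mul (hH m)))
        (.sum Finset.univ fun B => (hC₀ A B).mul (represents_monomialField B i)))
    filter_upwards [eventually_all.2 h1] with x hx
    ext i
    rw [hx i]
    simp [matrixMap_apply, Finset.sum_apply]
  · have h1 (i : Fin q) := IsRep.eventuallyEq
      (IsRep.add ((hX A).applyField hΔ i) (.sum Finset.univ fun m => (hWF A i m).mul (hΔ m)))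
      ((hdec₁ A i).symm ▸ IsRep.sum (f := fun B => c₁ A B * monomialField B i) Finset.univ
        fun B => (hC₁ A B).mul (represents_monomialField B i))
    filter_upwards [eventually_all.2 h1] with x hx
    ext i
    simpa [matrixMap_apply, Finset.sum_apply] using hx i
  · have h1 (i : Fin q) := IsRep.eventuallyEq (hΔ i)
      ((hd i).symm ▸ IsRep.sum (f := fun A => d A * monomialField A i) Finset.univ
        fun A => (hD A).mul (represents_monomialField A i))
    filter_upwards [eventually_all.2 h1] with x hx
    ext i
    rw [hx i]
    simp [Finset.sum_apply]

theorem jet_apply {l : ℕ} {f : SmoothGerm 𝕂 r p} {F : (Fin p → 𝕂) → 𝕂} (hF : IsRep f F)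
    (k : Fin (l + 1)) : jet l f k = iteratedFDeriv 𝕂 k F 0 := by
  obtain ⟨f, hf⟩ := f
  change f = _ at hF
  subst hF
  rfl

/-- Germs with equal jets have a difference that vanishes to high order, together with its
derivatives. -/
theorem sub_mem_of_jet_eq {l : ℕ} {f g : SmoothGerm 𝕂 r p} (h : jet l g = jet l f) :
    g - f ∈ maxIdeal 𝕂 r p ^ (l + 1) ∧ ∀ j, pderiv j (g - f) ∈ maxIdeal 𝕂 r p ^ l := by
  obtain ⟨F, hF⟩ := exists_isRep f
  obtain ⟨G, hG⟩ := exists_isRep g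
  have hGF := hG.sub hF
  have hs := hGF.smoothNear
  have hzero (k : ℕ) (hk : k < l + 1) : iteratedFDeriv 𝕂 k (fun x => G x - F x) 0 = 0 := by
    have h1 := congrFun h ⟨k, hk⟩
    rw [jet_apply hG, jet_apply hF] at h1
    rw [show (fun x => G x - F x) = G - F from rfl, iteratedFDeriv_sub_apply
      (hG.smoothNear.self_of_nhds.of_le (r.coe_le_order k))
      (hF.smoothNear.self_of_nhds.of_le (r.coe_le_order k))]
    exact sub_eq_zero.2 h1
  refine ⟨mem_maxIdeal_pow_of_isBigO hGF (isBigO_of_iteratedFDeriv_eq_zero (𝕂 := 𝕂) (l + 1)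
    (hs.mono fun x hx => hx.of_le (r.coe_le_order _)) hzero), fun j => ?_⟩
  have h2 := isBigO_of_iteratedFDeriv_eq_zero (𝕂 := 𝕂) l
    (F := fderiv 𝕂 fun x => G x - F x)
    (hs.mono fun x hx => (hx.fderiv_right r.order_add_one).of_le (r.coe_le_order _)) fun k hk => by
      rw [← norm_eq_zero, norm_iteratedFDeriv_fderiv, hzero _ (Nat.succ_lt_succ hk), norm_zero]
  refine mem_maxIdeal_pow_of_isBigO (hGF.pderiv j) (Asymptotics.IsBigO.trans ?_ h2)
  refine Asymptotics.IsBigO.of_bound ‖(Pi.single j 1 : Fin p → 𝕂)‖ (.of_forall fun x => ?_)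
  rw [mul_comm]
  exact ContinuousLinearMap.le_opNorm _ _

theorem mem_sq_of_mem_ThetaOne {V : Set (Fin p → 𝕂)} {ξ : Tuple 𝕂 r p p} (hξ : ξ ∈ ThetaOne r V)
    (j : Fin p) : ξ j ∈ maxIdeal 𝕂 r p ^ 2 := by
  obtain ⟨X, hX⟩ := exists_represents ξ
  obtain ⟨h0, h1⟩ := fderiv_eq_zero_of_mem_ThetaOne hξ hX
  have h2 := isBigO_of_iteratedFDeriv_eq_zero (𝕂 := 𝕂) 2
    (hX.smoothNear.mono fun x hx => hx.of_le (r.coe_le_order _)) fun i hi => by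
      rw [← norm_eq_zero]
      interval_cases i
      · rw [norm_iteratedFDeriv_zero, h0, norm_zero]
      · rw [norm_iteratedFDeriv_one, h1, norm_zero]
  refine mem_maxIdeal_pow_of_isBigO (hX j) (Asymptotics.IsBigO.trans ?_ h2)
  exact Asymptotics.IsBigO.of_bound 1 (.of_forall fun x => by
    rw [one_mul]; exact norm_le_pi_norm (X x) j)

theorem applyField_mem {ξ : Tuple 𝕂 r p p} {f : Tuple 𝕂 r p q} {a l : ℕ}
    (hξ : ∀ j, ξ j ∈ maxIdeal 𝕂 r p ^ a)
    (hf : ∀ i j, pderiv j (f i) ∈ maxIdeal 𝕂 r p ^ l) (i : Fin q) :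
    applyField ξ f i ∈ maxIdeal 𝕂 r p ^ (a + l) := by
  rw [pow_add]
  exact sum_mem fun j _ => Ideal.mul_mem_mul (hξ j) (hf i j)

end Determinacy

end VK

theorem theorem3p6 {𝕂 : Type*} [RCLike 𝕂] (r : VK.Regularity) {p q : ℕ} (V : Set (Fin p → 𝕂))
    (h : VK.Tuple 𝕂 r p q) (h_zero : ∀ i, h i ∈ VK.maxIdeal 𝕂 r p) (l : ℕ)
    (h_fg : ∃ S : Finset (VK.Tuple 𝕂 r p p),
      (Submodule.span (VK.SmoothGerm 𝕂 r p) (S : Set (VK.Tuple 𝕂 r p p)) :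
        Set (VK.Tuple 𝕂 r p p)) = VK.Theta r V) :
    ((VK.idealTheta q (VK.maxIdeal 𝕂 r p ^ (l + 1)) : Set (VK.Tuple 𝕂 r p q)) ⊆
        VK.tangentOne V h +
          (VK.idealTheta q (VK.maxIdeal 𝕂 r p ^ (l + 2)) : Set (VK.Tuple 𝕂 r p q)) →
      VK.Determined V l h) ∧
    ((∀ ξ ∈ VK.Theta r V, ∀ j, ξ j ∈ VK.maxIdeal 𝕂 r p) →
      (VK.idealTheta q (VK.maxIdeal 𝕂 r p ^ l) : Set (VK.Tuple 𝕂 r p q)) ⊆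
        VK.tangentExt V h +
          (VK.idealTheta q (VK.maxIdeal 𝕂 r p ^ (l + 1)) : Set (VK.Tuple 𝕂 r p q)) →
      VK.Determined V l h) := by
  constructor
  · intro hT g hg hjet
    -- Here `k = l + 1`. Differentiating `g - h` loses one order, which the fields in `𝔪²` more than
    -- restore: `2 + l = k + 1`.
    refine VK.equivalent_of_tangent (Θ := VK.ThetaOne r V) (J := VK.maxIdeal 𝕂 r p)
      (fun ξ ⟨Φ, h1, h2, _⟩ => ⟨Φ, h1, h2⟩)
      (fun ξ hξ j => Ideal.pow_le_self two_ne_zero (VK.mem_sq_of_mem_ThetaOne hξ j)) h_zero hT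
      (fun i => (VK.sub_mem_of_jet_eq (hjet i)).1) (fun ξ hξ i => ?_) fun w hw i => ?_
    · have h1 := VK.applyField_mem (VK.mem_sq_of_mem_ThetaOne hξ)
        (fun i => (VK.sub_mem_of_jet_eq (hjet i)).2) i
      rw [add_comm 2 l] at h1
      exact h1
    · rw [pow_succ']
      exact Ideal.mul_mem_mul hw (VK.sub_mem_of_jet_eq (hjet i)).1
  · intro hΘ0 hT g hg hjet
    -- Here `k = l`, one less than the order of `g - h`. This spare order allows fields merely in
    -- `𝔪`, since `1 + l = k + 1`, and arbitrary matrix coefficients.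
    refine VK.equivalent_of_tangent (Θ := VK.Theta r V) (J := ⊤) subset_rfl hΘ0 h_zero
      (by rw [Ideal.top_mul]; exact hT)
      (fun i => Ideal.pow_le_pow_right l.le_succ (VK.sub_mem_of_jet_eq (hjet i)).1)
      (fun ξ hξ i => ?_)
      fun w _ i => Ideal.mul_mem_left _ _ (VK.sub_mem_of_jet_eq (hjet i)).1
    have h1 := VK.applyField_mem (a := 1) (fun j => by rw [pow_one]; exact hΘ0 ξ hξ j)
      (fun i => (VK.sub_mem_of_jet_eq (hjet i)).2) i
    rw [add_comm 1 l] at h1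
    exact h1
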